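/- Let $L$ be the left shift on $\ell^2(\mathbb{Z})$, $(L\psi)(x)=\psi(x+1)$. Let $p\in\mathbb{R}$, $q\in\mathbb{C}$ with $p^2+|q|^2=1$, and let $a_1,a_2:\mathbb{Z}\to\mathbb{R}$, $b:\mathbb{Z}\to\mathbb{C}$ satisfy $a_j(x)^2+|b(x)|^2=1$ ($j=1,2$) and $b(x)(a_1(x)+a_2(x))=0$ for all $x\in\mathbb{Z}$. On $\mathcal{H}=\ell^2(\mathbb{Z})\oplus\ell^2(\mathbb{Z})$ consider the unitary involutions $$\varGamma=\begin{pmatrix}p&qL\\ q^*L^*&-p\end{pmatrix},\qquad C=\begin{pmatrix}a_1&b^*\\ b&a_2\end{pmatrix},$$ where $a_1,a_2,b$ act as multiplication operators. Put $Q=[\varGamma,C]/(2i)$ and $H=Q^2$. Since $Q$ anticommutes with $\varGamma$, it maps $\ker(\varGamma-1)$ into $\ker(\varGamma+1)$; denote this restriction by $Q_+:\ker(\varGamma-1)\to\ker(\varGamma+1)$. The operator $H$ leaves $\ker(\varGamma\mp1)$ invariant; denote by $H_\pm$ its restriction to $\ker(\varGamma\mp1)$. The pair $(\varGamma,C)$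 is called Fredholm if $Q_+$ is a Fredholm operator, and its Witten index is $\mathrm{ind}(\varGamma,C)=\dim\ker H_+-\dim\ker H_-$ whenever both dimensions are finite. Suppose that $C$ is anisotropic, i.e. that the matrices $C(x)=\begin{pmatrix}a_1(x)&b(x)^*\\ b(x)&a_2(x)\end{pmatrix}$ have limits $C(\mathrm{L})=\lim_{x\to-\infty}C(x)$ and $C(\mathrm{R})=\lim_{x\to+\infty}C(x)$, and that both limits are nontrivial, i.e. different from $\pm1$. For $\sharp=\mathrm{L},\mathrm{R}$ let $a(\sharp)\in\mathbb{R}$ be the upper left entry of $C(\sharp)$. Then: (A1) $(\varGamma,C)$ is Fredholm if and only if $|p|\neq|a(\sharp)|$ for each $\sharp=\mathrm{L},\mathrm{R}$. (A2) If $(\varGamma,C)$ is Fredholm, then $\ker H_+$ and $\ker H_-$ are finite-dimensional and $$\mathrm{ind}(\varGamma,C)=\begin{cases}+\operatorname{sgn}p,&|a(\mathrm{R})|<|p|<|a(\mathrm{L})|,\\ -\operatorname{sgn}p,&|a(\mathrm{L})|<|p|<|a(\mathrm{R})|,\\ 0,&\text{otherwise},\end{cases}$$ where $\operatorname{sgn}0=0$.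 -/

import Mathlib

open Filter Topology ComplexConjugate

noncomputable section

/-- A supersymmetric quantum walk (SUSYQW): a pair `(Γ, C)` of unitary involutions on a complex
Hilbert space. -/
structure SUSYQW (H : Type*) [NormedAddCommGroup H] [InnerProductSpace ℂ H] [CompleteSpace H] where
  Γ : H →L[ℂ] H
  C : H →L[ℂ] H
  Γ_unitary : Γ ∈ unitary (H →L[ℂ] H)
  Γ_involution : Γ * Γ = 1
  C_unitary : C ∈ unitary (H →L[ℂ] H)
  C_involution : C * C = 1

namespace SUSYQW

variable {H : Type*} [NormedAddCommGroup H] [InnerProductSpace ℂ H] [CompleteSpace H]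

/-- The supercharge `Q = [Γ, C] / 2i`. -/
def supercharge (S : SUSYQW H) : H →L[ℂ] H :=
  (2 * Complex.I)⁻¹ • (S.Γ * S.C - S.C * S.Γ)

/-- The superhamiltonian `Q²`. -/
def superhamiltonian (S : SUSYQW H) : H →L[ℂ] H := S.supercharge * S.supercharge

/-- `H₊ = ker (Γ - 1)`. -/
def plusSpace (S : SUSYQW H) : Submodule ℂ H := (S.Γ - 1).ker

/-- `H₋ = ker (Γ + 1)`. -/
def minusSpace (S : SUSYQW H) : Submodule ℂ H := (S.Γ + 1).ker

theorem mem_plusSpace (S : SUSYQW H) {v : H} : v ∈ S.plusSpace ↔ S.Γ v = v := by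
  simp [plusSpace, sub_eq_zero]

theorem mem_minusSpace (S : SUSYQW H) {v : H} : v ∈ S.minusSpace ↔ S.Γ v = -v := by
  simp [minusSpace, add_eq_zero_iff_eq_neg]

/-- The supercharge anticommutes with `Γ`. -/
theorem Γ_mul_supercharge (S : SUSYQW H) : S.Γ * S.supercharge = -(S.supercharge * S.Γ) := by
  have h := S.Γ_involution
  simp only [supercharge, mul_smul_comm, smul_mul_assoc, ← smul_neg]
  congr 1
  rw [mul_sub, sub_mul, mul_assoc S.C, h, ← mul_assoc S.Γ S.Γ, h, ← mul_assoc]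
  simp

theorem Γ_supercharge_apply (S : SUSYQW H) (v : H) :
    S.Γ (S.supercharge v) = -S.supercharge (S.Γ v) := by
  simpa using congrArg (fun T : H →L[ℂ] H => T v) S.Γ_mul_supercharge

theorem supercharge_plus (S : SUSYQW H) : ∀ v ∈ S.plusSpace, S.supercharge v ∈ S.minusSpace := by
  intro v hv
  rw [mem_minusSpace, Γ_supercharge_apply, S.mem_plusSpace.1 hv]

theorem supercharge_minus (S : SUSYQW H) : ∀ v ∈ S.minusSpace, S.supercharge v ∈ S.plusSpace := by
  intro v hv
  rw [mem_plusSpace, Γ_supercharge_apply, S.mem_minusSpace.1 hv]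
  simp

theorem superhamiltonian_plus (S : SUSYQW H) :
    ∀ v ∈ S.plusSpace, S.superhamiltonian v ∈ S.plusSpace :=
  fun v hv => S.supercharge_minus _ (S.supercharge_plus v hv)

theorem superhamiltonian_minus (S : SUSYQW H) :
    ∀ v ∈ S.minusSpace, S.superhamiltonian v ∈ S.minusSpace :=
  fun v hv => S.supercharge_plus _ (S.supercharge_minus v hv)

/-- The block `Q₊ : ker (Γ - 1) → ker (Γ + 1)` of the supercharge. -/
def superchargePlus (S : SUSYQW H) : S.plusSpace →L[ℂ] S.minusSpace :=
  S.supercharge.restrict S.supercharge_plus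

/-- The block of the superhamiltonian on `ker (Γ - 1)`. -/
def hamiltonianPlus (S : SUSYQW H) : S.plusSpace →L[ℂ] S.plusSpace :=
  S.superhamiltonian.restrict S.superhamiltonian_plus

/-- The block of the superhamiltonian on `ker (Γ + 1)`. -/
def hamiltonianMinus (S : SUSYQW H) : S.minusSpace →L[ℂ] S.minusSpace :=
  S.superhamiltonian.restrict S.superhamiltonian_minus

/-- `(Γ, C)` is Fredholm if `Q₊` is a Fredholm operator. -/
def IsFredholm (S : SUSYQW H) : Prop := S.superchargePlus.IsFredholm

/-- The Witten index is well defined as an integer: both kernels are finite-dimensional. -/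
def HasWittenIndex (S : SUSYQW H) : Prop :=
  FiniteDimensional ℂ S.hamiltonianPlus.ker ∧ FiniteDimensional ℂ S.hamiltonianMinus.ker

/-- The Witten index: the dimension of the kernel of the superhamiltonian on `ker (Γ - 1)` minus
that of its kernel on `ker (Γ + 1)`; meaningful when `HasWittenIndex` holds. -/
def wittenIndex (S : SUSYQW H) : ℤ :=
  (Module.finrank ℂ S.hamiltonianPlus.ker : ℤ) - (Module.finrank ℂ S.hamiltonianMinus.ker : ℤ)

end SUSYQW

/-- `ℓ²(ℤ)`. -/
abbrev EllTwo : Type := lp (fun _ : ℤ => ℂ) 2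

/-- The state space `ℓ²(ℤ) ⊕ ℓ²(ℤ)`, identified with `ℓ²(ℤ, ℂ²)`. -/
abbrev StateSpace : Type := WithLp 2 (EllTwo × EllTwo)

/-- Translating a square-summable sequence by an integer. -/
def shiftBy (n : ℤ) (ψ : EllTwo) : EllTwo :=
  ⟨fun x => ψ (x + n), by
    have h := (lp.memℓp ψ).summable (by norm_num)
    exact memℓp_gen ((Equiv.addRight n).summable_iff.2 h)⟩

/-- The left shift as a unitary map, `(L ψ)(x) = ψ (x + 1)`. -/
def leftShiftEquiv : EllTwo ≃ₗᵢ[ℂ] EllTwo where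
  toFun := shiftBy 1
  invFun := shiftBy (-1)
  map_add' _ _ := rfl
  map_smul' _ _ := rfl
  left_inv ψ := by
    ext x
    exact congrArg (fun y : ℤ => ψ y) (show x + -1 + 1 = x by ring)
  right_inv ψ := by
    ext x
    exact congrArg (fun y : ℤ => ψ y) (show x + 1 + -1 = x by ring)
  norm_map' ψ := by
    simp only [lp.norm_eq_tsum_rpow (p := 2) (by norm_num)]
    congr 1
    exact (Equiv.addRight (1 : ℤ)).tsum_eq (fun x => ‖ψ x‖ ^ (2 : ENNReal).toReal)

/-- The left shift operator `L` on `ℓ²(ℤ)`. -/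
def leftShift : EllTwo →L[ℂ] EllTwo := leftShiftEquiv.toContinuousLinearEquiv

/-- The operator of multiplication by a sequence bounded by `1`. -/
def mulOp (f : ℤ → ℂ) (hf : ∀ x, ‖f x‖ ≤ 1) : EllTwo →L[ℂ] EllTwo :=
  lp.mapCLM 2 (fun x => ContinuousLinearMap.mul ℂ ℂ (f x)) zero_le_one (by
    intro x
    simpa using hf x)

/-- The operator on `ℓ²(ℤ) ⊕ ℓ²(ℤ)` with `2 × 2` block matrix `(A, B; C, D)`. -/
def blockOp (A B C D : EllTwo →L[ℂ] EllTwo) : StateSpace →L[ℂ] StateSpace :=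
  (WithLp.prodContinuousLinearEquiv 2 ℂ EllTwo EllTwo).symm.toContinuousLinearMap ∘L
    ((A.coprod B).prod (C.coprod D)) ∘L
      (WithLp.prodContinuousLinearEquiv 2 ℂ EllTwo EllTwo).toContinuousLinearMap

theorem ellTwo_add_apply (φ ψ : EllTwo) (x : ℤ) : (φ + ψ) x = φ x + ψ x := rfl

theorem ellTwo_neg_apply (φ : EllTwo) (x : ℤ) : (-φ) x = -φ x := rfl

theorem ellTwo_smul_apply (c : ℂ) (φ : EllTwo) (x : ℤ) : (c • φ) x = c * φ x := rfl

@[simp]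
theorem leftShift_apply (ψ : EllTwo) (x : ℤ) : leftShift ψ x = ψ (x + 1) := rfl

@[simp]
theorem adjoint_leftShift_apply (ψ : EllTwo) (x : ℤ) :
    ContinuousLinearMap.adjoint leftShift ψ x = ψ (x - 1) := by
  have h : ContinuousLinearMap.adjoint leftShift =
      (leftShiftEquiv.symm.toContinuousLinearEquiv : EllTwo →L[ℂ] EllTwo) :=
    leftShiftEquiv.adjoint_eq_symm
  rw [h]
  rfl

@[simp]
theorem mulOp_apply (f : ℤ → ℂ) (hf : ∀ x, ‖f x‖ ≤ 1) (ψ : EllTwo) (x : ℤ) :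
    mulOp f hf ψ x = f x * ψ x := by
  simp [mulOp]

@[simp]
theorem blockOp_fst (A B C D : EllTwo →L[ℂ] EllTwo) (v : StateSpace) :
    (blockOp A B C D v).fst = A v.fst + B v.snd := rfl

@[simp]
theorem blockOp_snd (A B C D : EllTwo →L[ℂ] EllTwo) (v : StateSpace) :
    (blockOp A B C D v).snd = C v.fst + D v.snd := rfl

theorem blockOp_ext {S T : StateSpace →L[ℂ] StateSpace}
    (h₁ : ∀ v x, (S v).fst x = (T v).fst x) (h₂ : ∀ v x, (S v).snd x = (T v).snd x) : S = T := by
  refine ContinuousLinearMap.ext fun v => ?_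
  apply WithLp.ofLp_injective
  refine Prod.ext ?_ ?_
  · exact lp.ext (funext (h₁ v))
  · exact lp.ext (funext (h₂ v))

theorem adjoint_mulOp (f : ℤ → ℂ) (hf : ∀ x, ‖f x‖ ≤ 1) :
    ContinuousLinearMap.adjoint (mulOp f hf) =
      mulOp (fun x => conj (f x)) (fun x => by simpa using hf x) := by
  symm
  rw [ContinuousLinearMap.eq_adjoint_iff]
  intro φ ψ
  rw [lp.inner_eq_tsum, lp.inner_eq_tsum]
  refine tsum_congr fun x => ?_
  simp
  ring

theorem adjoint_blockOp (A B C D : EllTwo →L[ℂ] EllTwo) :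
    ContinuousLinearMap.adjoint (blockOp A B C D) =
      blockOp (ContinuousLinearMap.adjoint A) (ContinuousLinearMap.adjoint C)
        (ContinuousLinearMap.adjoint B) (ContinuousLinearMap.adjoint D) := by
  symm
  rw [ContinuousLinearMap.eq_adjoint_iff]
  intro φ ψ
  simp only [WithLp.prod_inner_apply, WithLp.ofLp_fst, WithLp.ofLp_snd, blockOp_fst, blockOp_snd,
    inner_add_left, inner_add_right, ContinuousLinearMap.adjoint_inner_left]
  ring

/-- The data of a one-dimensional split-step SUSYQW. The last three conditions say that every
local coin `(a₁ x, conj (b x); b x, a₂ x)` is a unitary involution. -/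
structure SplitStep where
  p : ℝ
  q : ℂ
  a₁ : ℤ → ℝ
  a₂ : ℤ → ℝ
  b : ℤ → ℂ
  shift_cond : p ^ 2 + ‖q‖ ^ 2 = 1
  coin_cond₁ : ∀ x, a₁ x ^ 2 + ‖b x‖ ^ 2 = 1
  coin_cond₂ : ∀ x, a₂ x ^ 2 + ‖b x‖ ^ 2 = 1
  coin_cond₃ : ∀ x, b x * (a₁ x + a₂ x) = 0

namespace SplitStep

theorem norm_a₁_le (W : SplitStep) (x : ℤ) : ‖(W.a₁ x : ℂ)‖ ≤ 1 := by
  rw [Complex.norm_real, Real.norm_eq_abs, ← sq_le_one_iff_abs_le_one]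
  nlinarith [W.coin_cond₁ x, sq_nonneg ‖W.b x‖]

theorem norm_a₂_le (W : SplitStep) (x : ℤ) : ‖(W.a₂ x : ℂ)‖ ≤ 1 := by
  rw [Complex.norm_real, Real.norm_eq_abs, ← sq_le_one_iff_abs_le_one]
  nlinarith [W.coin_cond₂ x, sq_nonneg ‖W.b x‖]

theorem norm_b_le (W : SplitStep) (x : ℤ) : ‖W.b x‖ ≤ 1 := by
  nlinarith [W.coin_cond₁ x, sq_nonneg (W.a₁ x), norm_nonneg (W.b x)]

theorem norm_conj_b_le (W : SplitStep) (x : ℤ) : ‖conj (W.b x)‖ ≤ 1 := by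
  simpa using W.norm_b_le x

/-- The shift operator `Γ = (p, q L; q* L*, -p)`. -/
def shiftOp (W : SplitStep) : StateSpace →L[ℂ] StateSpace :=
  blockOp ((W.p : ℂ) • 1) (W.q • leftShift)
    (conj W.q • ContinuousLinearMap.adjoint leftShift) (-(W.p : ℂ) • 1)

/-- The coin operator `C = (a₁, b*; b, a₂)`. -/
def coinOp (W : SplitStep) : StateSpace →L[ℂ] StateSpace :=
  blockOp (mulOp (fun x => W.a₁ x) W.norm_a₁_le) (mulOp (fun x => conj (W.b x)) W.norm_conj_b_le)
    (mulOp W.b W.norm_b_le) (mulOp (fun x => W.a₂ x) W.norm_a₂_le)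

/-- The local coin `C(x)`, a `2 × 2` matrix. -/
def coinAt (W : SplitStep) (x : ℤ) : Matrix (Fin 2) (Fin 2) ℂ :=
  !![(W.a₁ x : ℂ), conj (W.b x); W.b x, (W.a₂ x : ℂ)]

theorem adjoint_shiftOp (W : SplitStep) : ContinuousLinearMap.adjoint W.shiftOp = W.shiftOp := by
  have h : ContinuousLinearMap.adjoint (1 : EllTwo →L[ℂ] EllTwo) = 1 := star_one _
  have hs (c : ℂ) (A : EllTwo →L[ℂ] EllTwo) :
      ContinuousLinearMap.adjoint (c • A) = conj c • ContinuousLinearMap.adjoint A := star_smul c A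
  simp [shiftOp, adjoint_blockOp, h, hs, -Complex.coe_smul]

theorem adjoint_coinOp (W : SplitStep) : ContinuousLinearMap.adjoint W.coinOp = W.coinOp := by
  simp [coinOp, adjoint_blockOp, adjoint_mulOp]

theorem shiftOp_mul_self (W : SplitStep) : W.shiftOp * W.shiftOp = 1 := by
  have h : (W.p : ℂ) ^ 2 + W.q * conj W.q = 1 := by
    rw [Complex.mul_conj, Complex.normSq_eq_norm_sq]
    exact_mod_cast W.shift_cond
  apply blockOp_ext
  · intro v x
    simp [shiftOp, -Complex.coe_smul, -lp.coeFn_add, -lp.coeFn_neg, -lp.coeFn_smul, ellTwo_add_apply,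
      ellTwo_neg_apply, ellTwo_smul_apply]
    linear_combination (v.fst x) * h
  · intro v x
    simp [shiftOp, -Complex.coe_smul, -lp.coeFn_add, -lp.coeFn_neg, -lp.coeFn_smul, ellTwo_add_apply,
      ellTwo_neg_apply, ellTwo_smul_apply]
    linear_combination (v.snd x) * h

theorem coinOp_mul_self (W : SplitStep) : W.coinOp * W.coinOp = 1 := by
  have h₁ (x : ℤ) : (W.a₁ x : ℂ) ^ 2 + W.b x * conj (W.b x) = 1 := by
    rw [Complex.mul_conj, Complex.normSq_eq_norm_sq]
    exact_mod_cast W.coin_cond₁ x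
  have h₂ (x : ℤ) : (W.a₂ x : ℂ) ^ 2 + W.b x * conj (W.b x) = 1 := by
    rw [Complex.mul_conj, Complex.normSq_eq_norm_sq]
    exact_mod_cast W.coin_cond₂ x
  have h₃ (x : ℤ) : conj (W.b x) * ((W.a₁ x : ℂ) + W.a₂ x) = 0 := by
    simpa using congrArg conj (W.coin_cond₃ x)
  apply blockOp_ext
  · intro v x
    simp [coinOp, -lp.coeFn_add, ellTwo_add_apply]
    linear_combination (v.fst x) * h₁ x + (v.snd x) * h₃ x
  · intro v x
    simp [coinOp, -lp.coeFn_add, ellTwo_add_apply]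
    linear_combination (v.snd x) * h₂ x + (v.fst x) * W.coin_cond₃ x

/-- The split-step SUSYQW `(Γ, C)`. -/
def toSUSYQW (W : SplitStep) : SUSYQW StateSpace where
  Γ := W.shiftOp
  C := W.coinOp
  Γ_unitary := by
    rw [Unitary.mem_iff, ContinuousLinearMap.star_eq_adjoint, adjoint_shiftOp]
    exact ⟨W.shiftOp_mul_self, W.shiftOp_mul_self⟩
  Γ_involution := W.shiftOp_mul_self
  C_unitary := by
    rw [Unitary.mem_iff, ContinuousLinearMap.star_eq_adjoint, adjoint_coinOp]
    exact ⟨W.coinOp_mul_self, W.coinOp_mul_self⟩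
  C_involution := W.coinOp_mul_self

end SplitStep

end

/-! Choose half-angle parameters with `2c² = 1 + p`, `2s² = 1 - p`, `q = 2cse`, `|e| = 1`. Then `f ↦
(ceLf, sf)` and `f ↦ (-seLf, cf)` identify `ℓ²(ℤ)` with the two eigenspaces of `Γ`. In these
coordinates `Q₊` is, up to a unimodular factor, a Jacobi operator `T = A L + B + G L*` whose
diagonal coefficients `A`, `B`, `G` have limits at both ends (`SUSYQW.isFredholm_iff_and_index_eq`).

A nontrivial limit coin has trace zero. Writing `r² = 1 + a`, `t² = 1 - a` and `u` for the phase of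
`eb`, the limit of `T` at that end factors as `(ctu L - sr)(cr + stū L*)`. Let `P` be the projection
to a half-line. Modulo norm limits of finite rank operators `P` commutes with `L`, and `T` becomes a
product of four commuting factors, each of first order on one half-line and the identity on the
other (`toCalkin_jacobi`). By Atkinson's theorem `T` is Fredholm exactly when all four factors are,
and the indices add.

A factor `y + xS` cut to a half-line is invertible if `|x| < |y|`. If `|x| > |y|` its index is that
of the cut shift `S`, namely `±1`. If `|x| = |y|` it cannot be Fredholm, since arbitrarily small
perturbations have different indices (`IsShiftCut.norm_ne_of_isFredholm`). The comparisons `ct < sr`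
and `st < cr` say `p < a` and `-p < a`, which gives the criterion and the index of `Q₊`. That index
is the Witten index, because `Q` is self-adjoint and the range of `Q₊` is closed. -/

namespace LinearMap

/-! ### Index of the identity plus a finite rank map. -/

variable {K V : Type*} [Field K] [AddCommGroup V] [Module K V]

variable (f : V →ₗ[K] V)

theorem ker_one_add_le_range : ker (1 + f) ≤ range f := by
  intro x hx
  have h : x + f x = 0 := by simpa using hx
  exact ⟨-x, by rw [map_neg, eq_comm, eq_neg_iff_add_eq_zero, h]⟩

/-- A finite rank perturbation of the identity has index zero. -/
theorem index_one_add [FiniteDimensional K (range f)] : (1 + f).index = 0 := by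
  have hM : ∀ x ∈ range f, (1 + f) x ∈ range f := by
    intro x hx
    exact add_mem hx ⟨x, rfl⟩
  -- Kernel and cokernel of `1 + f` are those of its restriction `g` to the finite-dimensional range
  -- of `f`, and rank-nullity applies to `g`.
  let g : range f →ₗ[K] range f := (1 + f).restrict hM
  have e₁ : ker g ≃ₗ[K] ker (1 + f) :=
    { toFun := fun x => ⟨x.1.1, congrArg Subtype.val (mem_ker.1 x.2)⟩
      invFun := fun x => ⟨⟨x.1, ker_one_add_le_range f x.2⟩, Subtype.ext (mem_ker.1 x.2)⟩
      map_add' := fun _ _ => rfl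
      map_smul' := fun _ _ => rfl
      left_inv := fun _ => rfl
      right_inv := fun _ => rfl }
  let k : range f →ₗ[K] V ⧸ range (1 + f) := (range (1 + f)).mkQ ∘ₗ (range f).subtype
  have hk : ker k = range g := by
    ext ⟨y, hy⟩
    simp only [k, mem_ker, comp_apply, Submodule.subtype_apply, Submodule.mkQ_apply,
      Submodule.Quotient.mk_eq_zero]
    constructor
    · rintro ⟨x, hx⟩
      have hxy : x = y - f x := by
        rw [← hx]
        simp
      have hx' : x ∈ range f := by
        rw [hxy]
        exact sub_mem hy ⟨x, rfl⟩
      exact ⟨⟨x, hx'⟩, Subtype.ext hx⟩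
    · rintro ⟨x, hx⟩
      exact ⟨x.1, congrArg Subtype.val hx⟩
  have hs : range k = ⊤ := by
    rw [range_eq_top]
    intro y
    obtain ⟨v, rfl⟩ := (range (1 + f)).mkQ_surjective y
    refine ⟨⟨-f v, ⟨-v, by simp⟩⟩, ?_⟩
    simp only [k, comp_apply, Submodule.subtype_apply, Submodule.mkQ_apply, Submodule.Quotient.eq]
    refine ⟨-v, ?_⟩
    simp
    abel
  have h₁ := finrank_range_add_finrank_ker g
  have h₂ := finrank_range_add_finrank_ker k
  rw [e₁.finrank_eq] at h₁
  rw [hk, hs, finrank_top] at h₂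
  rw [index_eq_finrank_sub]
  omega

end LinearMap

/-! ### Fredholm operators: stability of the index and Atkinson's theorem. -/

namespace ContinuousLinearMap

open scoped LinearMap.FiniteRangeSetoid

section Banach

variable {𝕜 E F G : Type*} [RCLike 𝕜]
  [NormedAddCommGroup E] [NormedSpace 𝕜 E] [NormedAddCommGroup F] [NormedSpace 𝕜 F]
  [NormedAddCommGroup G] [NormedSpace 𝕜 G]

theorem IsFredholm.comp {g : F →L[𝕜] G} {f : E →L[𝕜] F} (hg : g.IsFredholm) (hf : f.IsFredholm) :
    (g ∘L f).IsFredholm := by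
  obtain ⟨v, hv⟩ := hf.exists_isQuasiInverse
  obtain ⟨w, hw⟩ := hg.exists_isQuasiInverse
  exact .of_isQuasiInverse (v := v ∘L w) (hv.comp hw)

theorem _root_.ContinuousLinearEquiv.isFredholm (e : E ≃L[𝕜] F) :
    (e : E →L[𝕜] F).IsFredholm :=
  .of_isQuasiInverse (v := (e.symm : F →L[𝕜] E)) e.toLinearEquiv.isQuasiInverse

theorem IsFredholm.index_comp {g : F →L[𝕜] G} {f : E →L[𝕜] F} (hg : g.IsFredholm)
    (hf : f.IsFredholm) :
    (g ∘L f).toLinearMap.index = g.toLinearMap.index + f.toLinearMap.index := by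
  have := hf.finite_ker
  have := hg.finite_ker
  have : FiniteDimensional 𝕜 (F ⧸ f.toLinearMap.range) := hf.finite_coker
  have : FiniteDimensional 𝕜 (G ⧸ g.toLinearMap.range) := hg.finite_coker
  exact LinearMap.index_comp (f := f.toLinearMap) g.toLinearMap

theorem isFredholm_comp_equiv_iff {f : E →L[𝕜] F} (e : G ≃L[𝕜] E) :
    (f ∘L (e : G →L[𝕜] E)).IsFredholm ↔ f.IsFredholm := by
  refine ⟨fun h => ?_, fun h => h.comp e.isFredholm⟩
  have := h.comp e.symm.isFredholm
  rwa [comp_assoc, ContinuousLinearEquiv.coe_comp_coe_symm, comp_id] at this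

theorem isFredholm_equiv_comp_iff {f : E →L[𝕜] F} (e : F ≃L[𝕜] G) :
    ((e : F →L[𝕜] G) ∘L f).IsFredholm ↔ f.IsFredholm := by
  refine ⟨fun h => ?_, fun h => e.isFredholm.comp h⟩
  have := e.symm.isFredholm.comp h
  rwa [← comp_assoc, ContinuousLinearEquiv.coe_symm_comp_coe, id_comp] at this

/-- A continuous endomorphism has finite rank. -/
def FiniteRank (f : E →L[𝕜] E) : Prop := f.toLinearMap.HasFiniteRange

theorem FiniteRank.add {f g : E →L[𝕜] E} (hf : f.FiniteRank) (hg : g.FiniteRank) :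
    (f + g).FiniteRank :=
  LinearMap.HasFiniteRange.add hf hg

theorem FiniteRank.neg {f : E →L[𝕜] E} (hf : f.FiniteRank) : (-f).FiniteRank :=
  LinearMap.HasFiniteRange.neg hf

theorem FiniteRank.mul_left {f : E →L[𝕜] E} (hf : f.FiniteRank) (g : E →L[𝕜] E) :
    (g * f).FiniteRank :=
  LinearMap.HasFiniteRange.comp_left hf g.toLinearMap

theorem FiniteRank.mul_right {f : E →L[𝕜] E} (hf : f.FiniteRank) (g : E →L[𝕜] E) :
    (f * g).FiniteRank :=
  LinearMap.HasFiniteRange.comp_right hf g.toLinearMap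

theorem FiniteRank.zero : (0 : E →L[𝕜] E).FiniteRank :=
  LinearMap.HasFiniteRange.zero

theorem isFredholm_iff_exists_finiteRank {f : E →L[𝕜] E} :
    f.IsFredholm ↔ ∃ v, (v * f - 1).FiniteRank ∧ (f * v - 1).FiniteRank := by
  rw [isFredholm_iff_exists_isQuasiInverse]
  refine exists_congr fun v => ?_
  exact and_congr LinearMap.FiniteRangeSetoid.equiv_iff_hasFiniteRange
    LinearMap.FiniteRangeSetoid.equiv_iff_hasFiniteRange

/-- As in a ring, where a left and a right inverse agree: modulo finite rank, `u = u(fv) = (uf)v =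
v`. So separate one-sided quasi-inverses suffice. -/
theorem isFredholm_of_finiteRank {f u v : E →L[𝕜] E} (hu : (u * f - 1).FiniteRank)
    (hv : (f * v - 1).FiniteRank) : f.IsFredholm := by
  rw [isFredholm_iff_exists_finiteRank]
  refine ⟨u, hu, ?_⟩
  have h : f * u - 1 = -(f * u * (f * v - 1)) + f * (u * f - 1) * v + (f * v - 1) := by
    noncomm_ring
  rw [h]
  exact ((hv.mul_left _).neg.add ((hu.mul_left _).mul_right _)).add hv

theorem isFredholm_of_isUnit {f : E →L[𝕜] E} (hf : IsUnit f) : f.IsFredholm := by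
  obtain ⟨u, rfl⟩ := hf
  rw [isFredholm_iff_exists_finiteRank]
  refine ⟨(u⁻¹ : (E →L[𝕜] E)ˣ), ?_, ?_⟩ <;> simpa using FiniteRank.zero

theorem index_of_isUnit {f : E →L[𝕜] E} (hf : IsUnit f) : f.toLinearMap.index = 0 := by
  obtain ⟨u, rfl⟩ := hf
  exact LinearEquiv.index_eq_zero (e := (ContinuousLinearEquiv.ofUnit u).toLinearEquiv)

theorem index_one_add_of_finiteRank {f : E →L[𝕜] E} (hf : f.FiniteRank) :
    (1 + f).toLinearMap.index = 0 := by
  have : FiniteDimensional 𝕜 f.toLinearMap.range := Module.Finite.of_fg hf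
  exact LinearMap.index_one_add f.toLinearMap

theorem isFredholm_one_add_of_finiteRank {f : E →L[𝕜] E} (hf : f.FiniteRank) :
    (1 + f).IsFredholm := by
  rw [isFredholm_iff_exists_finiteRank]
  exact ⟨1, by simpa using hf, by simpa using hf⟩

theorem isFredholm_and_index_of_isUnit_add {f g : E →L[𝕜] E} (hf : IsUnit f) (hg : g.FiniteRank) :
    (f + g).IsFredholm ∧ (f + g).toLinearMap.index = 0 := by
  obtain ⟨u, rfl⟩ := hf
  have h : (u : E →L[𝕜] E) + g = u * (1 + (u⁻¹ : (E →L[𝕜] E)ˣ) * g) := by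
    rw [mul_add, mul_one, Units.mul_inv_cancel_left]
  have h₁ := isFredholm_of_isUnit u.isUnit
  have h₂ := hg.mul_left (u⁻¹ : (E →L[𝕜] E)ˣ)
  have h₃ := isFredholm_one_add_of_finiteRank h₂
  rw [h]
  refine ⟨h₁.comp h₃, (h₁.index_comp h₃).trans ?_⟩
  rw [index_of_isUnit u.isUnit, index_one_add_of_finiteRank h₂, add_zero]

theorem isUnit_one_add [CompleteSpace E] {f : E →L[𝕜] E} (hf : ‖f‖ < 1) : IsUnit (1 + f) := by
  rw [← sub_neg_eq_add]
  exact isUnit_one_sub_of_norm_lt_one (by rwa [norm_neg])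

variable (𝕜 E) in
/-- The ideal of norm limits of finite rank operators. -/
def approxFiniteRank : TwoSidedIdeal (E →L[𝕜] E) :=
  .mk' (closure {f | f.FiniteRank})
    (subset_closure FiniteRank.zero)
    (fun hf hg => map_mem_closure₂ continuous_add hf hg fun _ ha _ hb => FiniteRank.add ha hb)
    (fun hf => map_mem_closure continuous_neg hf fun _ ha => FiniteRank.neg ha)
    (fun {f _} hg => map_mem_closure (continuous_const_mul f) hg fun _ ha => FiniteRank.mul_left ha f)
    (fun {_ g} hf => map_mem_closure (f := (· * g)) (continuous_mul_const g) hf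
      fun _ ha => FiniteRank.mul_right ha g)

theorem mem_approxFiniteRank_iff_mem_closure {f : E →L[𝕜] E} :
    f ∈ approxFiniteRank 𝕜 E ↔ f ∈ closure {f : E →L[𝕜] E | f.FiniteRank} := by
  rw [approxFiniteRank, TwoSidedIdeal.mem_mk']

theorem FiniteRank.mem_approxFiniteRank {f : E →L[𝕜] E} (hf : f.FiniteRank) :
    f ∈ approxFiniteRank 𝕜 E :=
  mem_approxFiniteRank_iff_mem_closure.2 (subset_closure hf)

theorem mem_approxFiniteRank_iff {f : E →L[𝕜] E} :
    f ∈ approxFiniteRank 𝕜 E ↔ ∀ ε > 0, ∃ e g : E →L[𝕜] E, ‖e‖ < ε ∧ g.FiniteRank ∧ f = e + g := by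
  rw [mem_approxFiniteRank_iff_mem_closure, Metric.mem_closure_iff]
  refine forall₂_congr fun ε _ => ?_
  constructor
  · rintro ⟨g, hg, hfg⟩
    exact ⟨f - g, g, by rwa [← dist_eq_norm], hg, by simp⟩
  · rintro ⟨e, g, he, hg, rfl⟩
    exact ⟨g, hg, by simpa [dist_eq_norm] using he⟩

variable (𝕜 E) in
/-- The quotient of the algebra of operators by the norm limits of finite rank operators. -/
abbrev Calkin : Type _ := (approxFiniteRank 𝕜 E).ringCon.Quotient

variable (𝕜 E) in
/-- The quotient map to the Calkin algebra. -/
def toCalkin : (E →L[𝕜] E) →ₐ[𝕜] Calkin 𝕜 E := (approxFiniteRank 𝕜 E).ringCon.mkₐ 𝕜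

theorem toCalkin_surjective : Function.Surjective (toCalkin 𝕜 E) := RingCon.mk'_surjective _

theorem toCalkin_eq_iff {f g : E →L[𝕜] E} :
    toCalkin 𝕜 E f = toCalkin 𝕜 E g ↔ f - g ∈ approxFiniteRank 𝕜 E := by
  rw [← TwoSidedIdeal.rel_iff]
  exact RingCon.eq _

variable [CompleteSpace E]

/-- Fredholm operators and their index are stable under the sum of a small operator and a finite
rank operator. -/
theorem IsFredholm.exists_stable {f : E →L[𝕜] E} (hf : f.IsFredholm) :
    ∃ ε > 0, ∀ e g : E →L[𝕜] E, ‖e‖ < ε → g.FiniteRank →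
      (f + (e + g)).IsFredholm ∧ (f + (e + g)).toLinearMap.index = f.toLinearMap.index := by
  obtain ⟨v, hvf, hfv⟩ := isFredholm_iff_exists_finiteRank.1 hf
  have hv : v.IsFredholm := isFredholm_iff_exists_finiteRank.2 ⟨f, hfv, hvf⟩
  -- The radius makes `‖v‖‖e‖ < 1`, so `1 + ve` and `1 + ev` are invertible; the `+ 1` covers `v =
  -- 0`.
  refine ⟨(‖v‖ + 1)⁻¹, by positivity, fun e g he hg => ?_⟩
  have hpos : 0 < ‖v‖ + 1 := by positivity
  have hsmall : ‖v‖ * ‖e‖ < 1 := by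
    calc ‖v‖ * ‖e‖ ≤ (‖v‖ + 1) * ‖e‖ := by gcongr; linarith
      _ < (‖v‖ + 1) * (‖v‖ + 1)⁻¹ := by gcongr
      _ = 1 := mul_inv_cancel₀ hpos.ne'
  have h₁ : IsUnit (1 + v * e) := isUnit_one_add ((norm_mul_le _ _).trans_lt hsmall)
  have h₂ : IsUnit (1 + e * v) :=
    isUnit_one_add ((norm_mul_le _ _).trans_lt (by rwa [mul_comm]))
  have hl : v * (f + (e + g)) = (1 + v * e) + ((v * f - 1) + v * g) := by noncomm_ring
  have hr : (f + (e + g)) * v = (1 + e * v) + ((f * v - 1) + g * v) := by noncomm_ring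
  have hfl := hvf.add (hg.mul_left v)
  have hfr := hfv.add (hg.mul_right v)
  obtain ⟨a, ha⟩ := h₁
  obtain ⟨b, hb⟩ := h₂
  have hF : (f + (e + g)).IsFredholm := by
    refine isFredholm_of_finiteRank (u := (a⁻¹ : (E →L[𝕜] E)ˣ) * v)
      (v := v * (b⁻¹ : (E →L[𝕜] E)ˣ)) ?_ ?_
    · rw [mul_assoc, hl, ← ha, mul_add, Units.inv_mul, add_sub_cancel_left]
      exact hfl.mul_left _
    · rw [← mul_assoc, hr, ← hb, add_mul, Units.mul_inv, add_sub_cancel_left]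
      exact hfr.mul_right _
  refine ⟨hF, ?_⟩
  -- Both `v(f + e + g)` and `vf` have index zero, so the index of `v` determines that of `f + e +
  -- g` and of `f` alike.
  have i₁ := hv.index_comp hF
  have i₂ := hv.index_comp hf
  have i₃ : (v ∘L (f + (e + g))).toLinearMap.index = 0 := by
    have := (isFredholm_and_index_of_isUnit_add a.isUnit hfl).2
    rwa [ha, ← hl] at this
  have i₄ : (v ∘L f).toLinearMap.index = 0 := by
    have := index_one_add_of_finiteRank hvf
    rwa [add_sub_cancel] at this
  omega

theorem IsFredholm.index_stable {f : E →L[𝕜] E} (hf : f.IsFredholm) :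
    ∃ ε > 0, ∀ g : E →L[𝕜] E, ‖g - f‖ < ε → g.toLinearMap.index = f.toLinearMap.index := by
  obtain ⟨ε, hε, h⟩ := hf.exists_stable
  refine ⟨ε, hε, fun g hg => ?_⟩
  have := (h (g - f) 0 hg FiniteRank.zero).2
  rwa [add_zero, add_sub_cancel] at this

/-- Atkinson's theorem. -/
theorem isFredholm_iff_isUnit_toCalkin {f : E →L[𝕜] E} :
    f.IsFredholm ↔ IsUnit (toCalkin 𝕜 E f) := by
  constructor
  · intro hf
    obtain ⟨v, hvf, hfv⟩ := isFredholm_iff_exists_finiteRank.1 hf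
    rw [isUnit_iff_exists]
    refine ⟨toCalkin 𝕜 E v, ?_, ?_⟩ <;> rw [← map_mul, ← map_one (toCalkin 𝕜 E), toCalkin_eq_iff]
    · exact hfv.mem_approxFiniteRank
    · exact hvf.mem_approxFiniteRank
  · intro hf
    obtain ⟨w, hfw, hwf⟩ := isUnit_iff_exists.1 hf
    obtain ⟨v, rfl⟩ := toCalkin_surjective w
    rw [← map_mul, ← map_one (toCalkin 𝕜 E), toCalkin_eq_iff, mem_approxFiniteRank_iff] at hfw hwf
    -- Tolerance `1` is enough: it makes `1 + e₁` and `1 + e₂` invertible by Neumann series.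
    obtain ⟨e₁, g₁, he₁, hg₁, h₁⟩ := hfw 1 one_pos
    obtain ⟨e₂, g₂, he₂, hg₂, h₂⟩ := hwf 1 one_pos
    obtain ⟨a, ha⟩ := isUnit_one_add he₁
    obtain ⟨b, hb⟩ := isUnit_one_add he₂
    rw [sub_eq_iff_eq_add', ← add_assoc] at h₁ h₂
    refine isFredholm_of_finiteRank (u := (b⁻¹ : (E →L[𝕜] E)ˣ) * v)
      (v := v * (a⁻¹ : (E →L[𝕜] E)ˣ)) ?_ ?_
    · rw [mul_assoc, h₂, ← hb, mul_add, Units.inv_mul, add_sub_cancel_left]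
      exact hg₂.mul_left _
    · rw [← mul_assoc, h₁, ← ha, add_mul, Units.mul_inv, add_sub_cancel_left]
      exact hg₁.mul_right _

/-- The difference is a finite rank operator plus one of norm below the stability radius of `f`. -/
theorem IsFredholm.index_congr {f g : E →L[𝕜] E} (hf : f.IsFredholm)
    (h : toCalkin 𝕜 E g = toCalkin 𝕜 E f) : g.toLinearMap.index = f.toLinearMap.index := by
  obtain ⟨ε, hε, hs⟩ := hf.exists_stable
  rw [toCalkin_eq_iff, mem_approxFiniteRank_iff] at h
  obtain ⟨e, k, he, hk, hgf⟩ := h ε hε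
  have := (hs e k he hk).2
  rwa [← hgf, add_sub_cancel] at this

end Banach

end ContinuousLinearMap

/-! ### Elements cut along an idempotent. -/

section Cut

variable {R : Type*} [Ring R] {P X Y : R}

/-- The element acting as `X` on the range of the idempotent `P` and as `1` on its kernel, provided
that `P` and `X` commute. -/
def cut (P X : R) : R := P * X + (1 - P)

theorem cut_one : cut P 1 = 1 := by simp [cut]

theorem map_cut {S F : Type*} [Ring S] [FunLike F R S] [RingHomClass F R S] (f : F) (P X : R) :
    f (cut P X) = cut (f P) (f X) := by
  simp [cut]

theorem cut_mul_cut (hP : P * P = P) (hX : Commute P X) : cut P X * cut P Y = cut P (X * Y) := by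
  have h₁ : P * X * (P * Y) = P * (X * Y) := by
    rw [hX.eq, mul_assoc, ← mul_assoc P P, hP, ← mul_assoc, ← hX.eq, mul_assoc]
  have h₂ : P * X * P = P * X := by
    rw [hX.eq, mul_assoc, hP]
  have h₃ : P * (P * Y) = P * Y := by rw [← mul_assoc, hP]
  simp only [cut, mul_add, add_mul, mul_sub, sub_mul, mul_one, one_mul, h₁, h₂, h₃, hP]
  abel

/-- This glues the behaviour `X` at one end to the behaviour `Y` at the other. -/
theorem cut_compl_mul_cut (hP : P * P = P) (hX : Commute P X) :
    cut (1 - P) X * cut P Y = (1 - P) * X + P * Y := by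
  have h₁ : X * (P * Y) = P * (X * Y) := by
    rw [← mul_assoc, ← hX.eq, mul_assoc]
  have h₂ : P * (P * (X * Y)) = P * (X * Y) := by rw [← mul_assoc, hP]
  have h₃ : P * (P * Y) = P * Y := by rw [← mul_assoc, hP]
  have h₄ : P * (P * X) = P * X := by rw [← mul_assoc, hP]
  simp only [cut, mul_add, add_mul, mul_sub, sub_mul, mul_one, one_mul, mul_assoc, h₁, h₂, h₃, hP,
    ← hX.eq, h₄]
  abel

theorem Commute.cut {P P' X X' : R} (h : Commute P P') (h₁ : Commute P X') (h₂ : Commute X P')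
    (h₃ : Commute X X') : Commute (cut P X) (cut P' X') := by
  unfold _root_.cut
  have a₁ := (h.mul_right h₁).mul_left (h₂.mul_right h₃)
  have a₂ : Commute (P * X) (1 - P') :=
    (Commute.one_right _).sub_right (h.mul_left h₂)
  have a₃ : Commute (1 - P) (P' * X') :=
    (Commute.one_left _).sub_left (h.mul_right h₁)
  have a₄ : Commute (1 - P) (1 - P') :=
    (Commute.one_left _).sub_left ((Commute.one_right _).sub_right h)
  exact (a₁.add_right a₂).add_left (a₃.add_right a₄)

end Cut

/-! ### First-order operators on the range of a projection. -/

namespace ContinuousLinearMap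

variable {𝕜 E : Type*} [RCLike 𝕜] [NormedAddCommGroup E] [NormedSpace 𝕜 E]

/-- Pull out the scalar `y` on the range of `P`; what remains is `1 + (x/y) P S`, a Neumann series.
`P` and `S` need not commute. -/
theorem isUnit_cut_add_smul [CompleteSpace E] {P S : E →L[𝕜] E} (hP : P * P = P) (hPS : ‖P * S‖ ≤ 1)
    {x y : 𝕜} (hxy : ‖x‖ < ‖y‖) : IsUnit (cut P (y • 1 + x • S)) := by
  have hy : y ≠ 0 := norm_pos_iff.1 ((norm_nonneg x).trans_lt hxy)
  have h₁ : IsUnit (cut P (y • (1 : E →L[𝕜] E))) := by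
    have hc (c : 𝕜) : Commute P (c • 1) := (Commute.one_right P).smul_right c
    rw [isUnit_iff_exists]
    refine ⟨cut P (y⁻¹ • 1), ?_, ?_⟩ <;> rw [cut_mul_cut hP (hc _)] <;>
      simp [smul_smul, hy, cut_one]
  have h₂ : IsUnit (1 + (x / y) • (P * S)) := by
    refine isUnit_one_add ?_
    calc ‖(x / y) • (P * S)‖ ≤ ‖x‖ / ‖y‖ * 1 := by
          rw [norm_smul, norm_div]
          gcongr
      _ < 1 := by
          rw [mul_one, div_lt_one (norm_pos_iff.2 hy)]
          exact hxy
  have h₃ : cut P (y • 1 + x • S) = cut P (y • 1) * (1 + (x / y) • (P * S)) := by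
    have h₄ : P * (P * S) = P * S := by rw [← mul_assoc, hP]
    simp only [cut, mul_add, add_mul, sub_mul, mul_one, one_mul, mul_smul_comm, smul_mul_assoc, h₄,
      smul_smul, sub_self, add_zero, div_mul_cancel₀ x hy]
    abel
  rw [h₃]
  exact h₁.mul h₂

/-- A projection `P` and an invertible isometry `S` with inverse `S'` that commute modulo norm
limits of finite rank operators. -/
structure IsShiftCut (P S S' : E →L[𝕜] E) : Prop where
  idem : P * P = P
  norm_proj_le : ‖P‖ ≤ 1
  norm_le : ‖S‖ ≤ 1
  norm_inv_le : ‖S'‖ ≤ 1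
  mul_inv : S * S' = 1
  inv_mul : S' * S = 1
  commute : Commute (toCalkin 𝕜 E P) (toCalkin 𝕜 E S)

namespace IsShiftCut

variable {P S S' : E →L[𝕜] E}

theorem commute_inv (h : IsShiftCut P S S') : Commute (toCalkin 𝕜 E P) (toCalkin 𝕜 E S') := by
  let u : (Calkin 𝕜 E)ˣ := ⟨toCalkin 𝕜 E S, toCalkin 𝕜 E S',
    by rw [← map_mul, h.mul_inv, map_one], by rw [← map_mul, h.inv_mul, map_one]⟩
  exact Commute.units_inv_right (u := u) h.commute

theorem inv (h : IsShiftCut P S S') : IsShiftCut P S' S :=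
  ⟨h.idem, h.norm_proj_le, h.norm_inv_le, h.norm_le, h.inv_mul, h.mul_inv, h.commute_inv⟩

theorem norm_mul_le (h : IsShiftCut P S S') : ‖P * S‖ ≤ 1 :=
  (_root_.norm_mul_le P S).trans (mul_le_one₀ h.norm_proj_le (norm_nonneg S) h.norm_le)

theorem toCalkin_idem (h : IsShiftCut P S S') :
    toCalkin 𝕜 E P * toCalkin 𝕜 E P = toCalkin 𝕜 E P := by
  rw [← map_mul, h.idem]

/-- Cutting is multiplicative only after passing to the quotient, since `P` and `S` are assumed to
commute only there. -/
theorem toCalkin_cut_mul (h : IsShiftCut P S S') (Y : E →L[𝕜] E) :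
    toCalkin 𝕜 E (cut P (S * Y)) = toCalkin 𝕜 E (cut P S * cut P Y) := by
  rw [map_mul, map_cut, map_cut, map_cut, cut_mul_cut h.toCalkin_idem h.commute, map_mul]

variable [CompleteSpace E]

theorem isFredholm_cut (h : IsShiftCut P S S') : (cut P S).IsFredholm := by
  rw [isFredholm_iff_isUnit_toCalkin, isUnit_iff_exists]
  refine ⟨toCalkin 𝕜 E (cut P S'), ?_, ?_⟩
  · rw [← map_mul, ← h.toCalkin_cut_mul, h.mul_inv, cut_one, map_one]
  · rw [← map_mul, ← h.inv.toCalkin_cut_mul, h.inv_mul, cut_one, map_one]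

theorem index_cut_inv (h : IsShiftCut P S S') :
    (cut P S').toLinearMap.index = -(cut P S).toLinearMap.index := by
  have h₁ := h.isFredholm_cut.index_comp h.inv.isFredholm_cut
  have h₂ := (isFredholm_of_isUnit (𝕜 := 𝕜) (E := E) isUnit_one).index_congr (g := cut P S * cut P S')
    (by rw [← h.toCalkin_cut_mul, h.mul_inv, cut_one])
  rw [index_of_isUnit isUnit_one] at h₂
  have h₃ : (cut P S ∘L cut P S').toLinearMap.index = 0 := h₂
  omega

/-- If `y` dominates, the operator is invertible. If `x` dominates, write `y + xS = S(x + yS')`: the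
second factor is invertible once cut, so only the cut shift contributes. -/
theorem isFredholm_and_index (h : IsShiftCut P S S') {x y : 𝕜} (hxy : ‖x‖ ≠ ‖y‖) :
    (cut P (y • 1 + x • S)).IsFredholm ∧ (cut P (y • 1 + x • S)).toLinearMap.index =
      if ‖x‖ < ‖y‖ then 0 else (cut P S).toLinearMap.index := by
  split_ifs with hlt
  · have hu := isUnit_cut_add_smul h.idem h.norm_mul_le hlt
    exact ⟨isFredholm_of_isUnit hu, index_of_isUnit hu⟩
  · have hu := isUnit_cut_add_smul h.idem h.inv.norm_mul_le (lt_of_le_of_ne (not_lt.1 hlt) hxy.symm)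
    have h₁ : S * (x • 1 + y • S') = y • 1 + x • S := by
      rw [mul_add, mul_smul_comm, mul_smul_comm, mul_one, h.mul_inv, add_comm]
    have h₂ := h.toCalkin_cut_mul (x • 1 + y • S')
    rw [h₁] at h₂
    have h₃ := isFredholm_of_isUnit hu
    have h₄ : (cut P S * cut P (x • 1 + y • S')).IsFredholm := h.isFredholm_cut.comp h₃
    refine ⟨?_, (h₄.index_congr h₂).trans ?_⟩
    · rwa [isFredholm_iff_isUnit_toCalkin, h₂, ← isFredholm_iff_isUnit_toCalkin]
    · refine (h.isFredholm_cut.index_comp h₃).trans ?_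
      rw [index_of_isUnit hu, add_zero]

theorem _root_.RCLike.exists_norm_eq_add (x : 𝕜) {δ : ℝ} (hδ : 0 ≤ δ) :
    ∃ x' : 𝕜, ‖x'‖ = ‖x‖ + δ ∧ ‖x' - x‖ = δ := by
  by_cases hx : x = 0
  · exact ⟨(δ : 𝕜), by simp [hx, abs_of_nonneg hδ], by simp [hx, abs_of_nonneg hδ]⟩
  · have hx' : 0 < ‖x‖ := norm_pos_iff.2 hx
    refine ⟨x + ((δ / ‖x‖ : ℝ) : 𝕜) * x, ?_, ?_⟩
    · have : x + ((δ / ‖x‖ : ℝ) : 𝕜) * x = ((1 + δ / ‖x‖ : ℝ) : 𝕜) * x := by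
        push_cast
        ring
      rw [this, norm_mul, RCLike.norm_ofReal, abs_of_nonneg (by positivity)]
      field_simp
    · rw [add_sub_cancel_left, norm_mul, RCLike.norm_ofReal, abs_of_nonneg (by positivity)]
      field_simp

/-- If the index of `cut P S` does not vanish, then an operator of first order that is degenerate
on the range of `P` is not Fredholm. -/
theorem norm_ne_of_isFredholm (h : IsShiftCut P S S') (hS : (cut P S).toLinearMap.index ≠ 0)
    {x y : 𝕜} (hF : (cut P (y • 1 + x • S)).IsFredholm) : ‖x‖ ≠ ‖y‖ := by
  intro hxy
  obtain ⟨ε, hε, hs⟩ := hF.index_stable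
  -- Enlarging `|x|` or `|y|` by `ε/2` stays within the stability radius, but gives the index of
  -- `cut P S` in one case and `0` in the other.
  obtain ⟨x', hx', hx⟩ := RCLike.exists_norm_eq_add x (half_pos hε).le
  obtain ⟨y', hy', hy⟩ := RCLike.exists_norm_eq_add y (half_pos hε).le
  have h₁ := (h.isFredholm_and_index (x := x') (y := y) (by rw [hx', hxy]; linarith)).2
  have h₂ := (h.isFredholm_and_index (x := x) (y := y') (by rw [hy', hxy]; linarith)).2
  rw [if_neg (by rw [hx', hxy]; linarith)] at h₁
  rw [if_pos (by rw [hy', hxy]; linarith)] at h₂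
  rw [hs] at h₁
  · rw [hs, h₁] at h₂
    · exact hS h₂
    · have : cut P (y' • 1 + x • S) - cut P (y • 1 + x • S) = (y' - y) • P := by
        simp only [cut, mul_add, mul_smul_comm, mul_one, sub_smul]
        abel
      rw [this, norm_smul, hy]
      nlinarith [h.norm_proj_le]
  · have : cut P (y • 1 + x' • S) - cut P (y • 1 + x • S) = (x' - x) • (P * S) := by
      simp only [cut, mul_add, mul_smul_comm, mul_one, sub_smul]
      abel
    rw [this, norm_smul, hx]
    nlinarith [h.norm_mul_le]

end IsShiftCut

end ContinuousLinearMap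

namespace ContinuousLinearMap.IsShiftCut

variable {𝕜 E : Type*} [RCLike 𝕜] [NormedAddCommGroup E] [NormedSpace 𝕜 E] {P S S' : E →L[𝕜] E}

theorem compl (h : IsShiftCut P S S') (hP : ‖1 - P‖ ≤ 1) : IsShiftCut (1 - P) S S' where
  idem := by simp [mul_sub, sub_mul, h.idem]
  norm_proj_le := hP
  norm_le := h.norm_le
  norm_inv_le := h.norm_inv_le
  mul_inv := h.mul_inv
  inv_mul := h.inv_mul
  commute := by
    rw [map_sub, map_one]
    exact (Commute.one_left _).sub_left h.commute

/-- In the quotient the two complementary cuts multiply to `S`, which is invertible and so has index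
zero. -/
theorem index_cut_compl [CompleteSpace E] (h : IsShiftCut P S S') (hP : ‖1 - P‖ ≤ 1) :
    (cut (1 - P) S).toLinearMap.index = -(cut P S).toLinearMap.index := by
  have hS : IsUnit S := isUnit_iff_exists.2 ⟨S', h.mul_inv, h.inv_mul⟩
  have h₁ : toCalkin 𝕜 E (cut (1 - P) S * cut P S) = toCalkin 𝕜 E S := by
    rw [map_mul, map_cut, map_cut, map_sub, map_one, cut_compl_mul_cut h.toCalkin_idem h.commute,
      ← add_mul, sub_add_cancel, one_mul]
  have h₂ : (cut (1 - P) S ∘L cut P S).toLinearMap.index = 0 :=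
    ((isFredholm_of_isUnit hS).index_congr h₁).trans (index_of_isUnit hS)
  have h₃ := (h.compl hP).isFredholm_cut.index_comp h.isFredholm_cut
  omega

end ContinuousLinearMap.IsShiftCut

/-! ### The shift on `ℓ²(ℤ)` and the half-line projections. -/

noncomputable section

open ContinuousLinearMap

theorem ellTwo_sub_apply (φ ψ : EllTwo) (x : ℤ) : (φ - ψ) x = φ x - ψ x := rfl

theorem ellTwo_op_add_apply (A B : EllTwo →L[ℂ] EllTwo) (f : EllTwo) (x : ℤ) :
    (A + B) f x = A f x + B f x := rfl

theorem ellTwo_op_sub_apply (A B : EllTwo →L[ℂ] EllTwo) (f : EllTwo) (x : ℤ) :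
    (A - B) f x = A f x - B f x := rfl

theorem ellTwo_op_smul_apply (c : ℂ) (A : EllTwo →L[ℂ] EllTwo) (f : EllTwo) (x : ℤ) :
    (c • A) f x = c * A f x := rfl

theorem ellTwo_norm_le_of_diagonal {D : EllTwo →L[ℂ] EllTwo} {d : ℤ → ℂ}
    (hD : ∀ f x, D f x = d x * f x) {ε : ℝ} (hε : 0 ≤ ε) (hd : ∀ x, ‖d x‖ ≤ ε) : ‖D‖ ≤ ε := by
  have hd' (x : ℤ) : ‖ContinuousLinearMap.mul ℂ ℂ (d x)‖ ≤ ε := by simpa using hd x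
  have h : D = lp.mapCLM 2 (fun x => ContinuousLinearMap.mul ℂ ℂ (d x)) hε hd' := by
    ext f x
    simp [hD]
  rw [h]
  exact lp.norm_mapCLM_le ..

theorem finiteRank_of_support {D : EllTwo →L[ℂ] EllTwo} {s : Set ℤ} (hs : s.Finite)
    (hD : ∀ f, ∀ x ∉ s, D f x = 0) : D.FiniteRank := by
  have := hs.fintype
  let ev : D.toLinearMap.range →ₗ[ℂ] (s → ℂ) :=
    { toFun := fun f x => f.1 x
      map_add' := fun _ _ => rfl
      map_smul' := fun _ _ => rfl }
  have hev : Function.Injective ev := by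
    rintro ⟨_, f, rfl⟩ ⟨_, g, rfl⟩ h
    refine Subtype.ext (lp.ext (funext fun x => ?_))
    by_cases hx : x ∈ s
    · exact congrFun h ⟨x, hx⟩
    · exact (hD f x hx).trans (hD g x hx).symm
  have : Module.Finite ℂ D.toLinearMap.range := Module.Finite.of_injective ev hev
  exact Module.Finite.iff_fg.1 this

/-- Only finitely many entries have modulus at least `ε/2`. They form a finite rank operator, and
the rest has norm at most `ε/2`. -/
theorem mem_approxFiniteRank_of_diagonal {D : EllTwo →L[ℂ] EllTwo} {d : ℤ → ℂ}
    (hD : ∀ f x, D f x = d x * f x) (hd : Tendsto d cofinite (𝓝 0)) :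
    D ∈ approxFiniteRank ℂ EllTwo := by
  rw [mem_approxFiniteRank_iff]
  intro ε hε
  classical
  let s : Set ℤ := {x | ¬ ‖d x‖ < ε / 2}
  have hs : s.Finite := by
    have := hd.norm.eventually_lt_const (u := ε / 2) (by simpa using hε)
    exact Filter.eventually_cofinite.1 this
  let c : ℤ → ℂ := fun x => if x ∈ s then 1 else 0
  have hc (x : ℤ) : ‖c x‖ ≤ 1 := by
    simp only [c]
    split_ifs <;> simp
  refine ⟨D - D * mulOp c hc, D * mulOp c hc, ?_, finiteRank_of_support hs ?_, by simp⟩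
  · refine (ellTwo_norm_le_of_diagonal (d := fun x => d x * (1 - c x)) (ε := ε / 2) ?_
      (half_pos hε).le ?_).trans_lt (half_lt_self hε)
    · intro f x
      rw [ellTwo_op_sub_apply, mul_apply_eq_comp, hD, hD,
        mulOp_apply]
      ring
    · intro x
      by_cases hx : x ∈ s
      · simpa [c, hx] using (half_pos hε).le
      · simp only [c, hx, if_false, sub_zero, mul_one]
        exact (not_not.1 hx).le
  · intro f x hx
    simp [hD, c, hx]

/-- The projection to the right half-line. -/
def rightProj : EllTwo →L[ℂ] EllTwo :=
  mulOp (fun x => if 0 ≤ x then 1 else 0) (fun x => by split_ifs <;> simp)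

theorem rightProj_apply (f : EllTwo) (x : ℤ) :
    rightProj f x = (if 0 ≤ x then 1 else 0) * f x :=
  mulOp_apply ..

theorem norm_leftShift_le : ‖leftShift‖ ≤ 1 :=
  ContinuousLinearMap.opNorm_le_bound _ zero_le_one fun f => by
    rw [one_mul]
    exact (leftShiftEquiv.norm_map f).le

theorem norm_one_sub_rightProj_le : ‖1 - rightProj‖ ≤ 1 := by
  refine ellTwo_norm_le_of_diagonal (d := fun x => if 0 ≤ x then 0 else 1) ?_ zero_le_one ?_
  · intro f x
    rw [ellTwo_op_sub_apply, rightProj_apply]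
    split_ifs <;> simp
  · intro x
    split_ifs <;> simp

theorem isShiftCut_rightProj :
    IsShiftCut rightProj leftShift (ContinuousLinearMap.adjoint leftShift) where
  idem := by
    ext f x
    rw [mul_apply_eq_comp, rightProj_apply, rightProj_apply]
    split_ifs <;> simp
  norm_proj_le := ellTwo_norm_le_of_diagonal rightProj_apply zero_le_one fun x => by
    split_ifs <;> simp
  norm_le := norm_leftShift_le
  norm_inv_le := by
    rw [LinearIsometryEquiv.norm_map]
    exact norm_leftShift_le
  mul_inv := by
    ext f x
    simp
  inv_mul := by
    ext f x
    simp
  commute := by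
    rw [Commute, SemiconjBy, ← map_mul, ← map_mul, toCalkin_eq_iff]
    -- The commutator sees only the site `-1`, from which `L` reads across the cut at `0`.
    refine FiniteRank.mem_approxFiniteRank (finiteRank_of_support (Set.finite_singleton (-1)) ?_)
    intro f x hx
    have hx' : x ≠ -1 := hx
    rw [ellTwo_op_sub_apply, mul_apply_eq_comp,
      mul_apply_eq_comp, leftShift_apply, rightProj_apply, rightProj_apply,
      leftShift_apply]
    have : (0 ≤ x) ↔ 0 ≤ x + 1 := by omega
    simp [this]

theorem isShiftCut_leftProj :
    IsShiftCut (1 - rightProj) leftShift (ContinuousLinearMap.adjoint leftShift) :=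
  isShiftCut_rightProj.compl norm_one_sub_rightProj_le

theorem cut_rightProj_leftShift_apply (f : EllTwo) (x : ℤ) :
    cut rightProj leftShift f x = if 0 ≤ x then f (x + 1) else f x := by
  have h : cut rightProj leftShift f x = rightProj (leftShift f) x + (f x - rightProj f x) := rfl
  rw [h, rightProj_apply, rightProj_apply, leftShift_apply]
  split_ifs <;> simp

/-- The cut shift is the backward shift on the right half-line and the identity on the left: it is
onto, and its kernel is spanned by the unit vector at `0`. -/
theorem index_cut_rightProj : (cut rightProj leftShift).toLinearMap.index = 1 := by
  have hs : Function.Surjective (cut rightProj leftShift).toLinearMap := by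
    intro g
    refine ⟨ContinuousLinearMap.adjoint leftShift (rightProj g) + (g - rightProj g), ?_⟩
    refine lp.ext (funext fun x => ?_)
    rw [ContinuousLinearMap.coe_coe, cut_rightProj_leftShift_apply]
    simp only [ellTwo_add_apply, ellTwo_sub_apply, adjoint_leftShift_apply, rightProj_apply]
    rcases lt_or_ge x 0 with hx | hx
    · simp [hx.not_ge, show ¬ (1 ≤ x) by omega]
    · simp [hx, show 0 ≤ x + 1 by omega]
  rw [LinearMap.index_of_surjective hs]
  have hker : (lp.single 2 0 (1 : ℂ) : EllTwo) ∈ (cut rightProj leftShift).toLinearMap.ker := by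
    rw [LinearMap.mem_ker]
    refine lp.ext (funext fun x => ?_)
    rw [ContinuousLinearMap.coe_coe, cut_rightProj_leftShift_apply]
    split_ifs with hx
    · rw [lp.single_apply_ne _ _ _ (by omega)]; rfl
    · rw [lp.single_apply_ne _ _ _ (by omega)]; rfl
  have h1 := finrank_eq_one_iff_of_nonzero' (K := ℂ)
    (⟨_, hker⟩ : (cut rightProj leftShift).toLinearMap.ker) (by
      intro h
      have := congrArg (fun f : EllTwo => f 0) (congrArg Subtype.val h)
      simp at this)
  rw [h1.2]
  · rfl
  · rintro ⟨f, hf⟩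
    refine ⟨f 0, Subtype.ext (lp.ext (funext fun x => ?_))⟩
    have hf' (y : ℤ) : (if 0 ≤ y then f (y + 1) else f y) = 0 := by
      rw [← cut_rightProj_leftShift_apply]
      exact congrArg (fun g : EllTwo => g y) (LinearMap.mem_ker.1 hf)
    have h2 : (f 0 • (lp.single 2 0 (1 : ℂ) : EllTwo)) x = f 0 * (lp.single 2 0 (1 : ℂ) : EllTwo) x :=
      rfl
    refine h2.trans ?_
    rcases lt_trichotomy x 0 with hx | rfl | hx
    · have := hf' x
      rw [if_neg (by omega)] at this
      rw [lp.single_apply_ne _ _ _ (by omega)]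
      simp [this]
    · simp
    · have := hf' (x - 1)
      rw [if_pos (by omega), sub_add_cancel] at this
      rw [lp.single_apply_ne _ _ _ (by omega)]
      simp [this]

theorem index_cut_leftProj : (cut (1 - rightProj) leftShift).toLinearMap.index = -1 := by
  rw [isShiftCut_rightProj.index_cut_compl norm_one_sub_rightProj_le, index_cut_rightProj]

end

/-! ### Jacobi operators whose coefficients have limits at both ends. -/

noncomputable section

open ContinuousLinearMap

/-- Subtracting the step function with values `l` and `r` leaves a diagonal operator with entries
tending to zero. -/
theorem toCalkin_eq_of_diagonal {D : EllTwo →L[ℂ] EllTwo} {d : ℤ → ℂ} {l r : ℂ}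
    (hD : ∀ f x, D f x = d x * f x) (hl : Tendsto d atBot (𝓝 l)) (hr : Tendsto d atTop (𝓝 r)) :
    toCalkin ℂ EllTwo D =
      (1 - toCalkin ℂ EllTwo rightProj) * algebraMap ℂ _ l +
        toCalkin ℂ EllTwo rightProj * algebraMap ℂ _ r := by
  have h : (1 - toCalkin ℂ EllTwo rightProj) * algebraMap ℂ _ l +
      toCalkin ℂ EllTwo rightProj * algebraMap ℂ _ r =
        toCalkin ℂ EllTwo (l • (1 - rightProj) + r • rightProj) := by
    simp [Algebra.smul_def, Algebra.commutes]
  rw [h, toCalkin_eq_iff]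
  refine mem_approxFiniteRank_of_diagonal (d := fun x => d x - if 0 ≤ x then r else l) ?_ ?_
  · intro f x
    rw [ellTwo_op_sub_apply, ellTwo_op_add_apply, ellTwo_op_smul_apply, ellTwo_op_smul_apply,
      ellTwo_op_sub_apply, rightProj_apply, one_apply_eq_self, hD]
    split_ifs <;> ring
  · rw [Int.cofinite_eq, tendsto_sup]
    constructor
    · refine (tendsto_sub_nhds_zero_iff.2 hl).congr' ?_
      filter_upwards [eventually_lt_atBot 0] with x hx
      rw [if_neg hx.not_ge]
    · refine (tendsto_sub_nhds_zero_iff.2 hr).congr' ?_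
      filter_upwards [eventually_ge_atTop 0] with x hx
      rw [if_pos hx]

variable {A B G : EllTwo →L[ℂ] EllTwo} {a b g : ℤ → ℂ}

/-- In the quotient the operator is `(1 - P)` times its left limit plus `P` times its right limit.
Each limit is `(y + xL)(w + zL*)`, and cutting respects products there. -/
theorem toCalkin_jacobi (hA : ∀ f n, A f n = a n * f n) (hB : ∀ f n, B f n = b n * f n)
    (hG : ∀ f n, G f n = g n * f n)
    {x₁ y₁ z₁ w₁ x₂ y₂ z₂ w₂ : ℂ}
    (ha₁ : Tendsto a atBot (𝓝 (x₁ * w₁))) (ha₂ : Tendsto a atTop (𝓝 (x₂ * w₂)))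
    (hb₁ : Tendsto b atBot (𝓝 (y₁ * w₁ + x₁ * z₁))) (hb₂ : Tendsto b atTop (𝓝 (y₂ * w₂ + x₂ * z₂)))
    (hg₁ : Tendsto g atBot (𝓝 (y₁ * z₁))) (hg₂ : Tendsto g atTop (𝓝 (y₂ * z₂))) :
    toCalkin ℂ EllTwo (A * leftShift + B + G * ContinuousLinearMap.adjoint leftShift) =
      toCalkin ℂ EllTwo (cut (1 - rightProj) (y₁ • 1 + x₁ • leftShift)) *
        toCalkin ℂ EllTwo
          (cut (1 - rightProj) (w₁ • 1 + z₁ • ContinuousLinearMap.adjoint leftShift)) *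
      (toCalkin ℂ EllTwo (cut rightProj (y₂ • 1 + x₂ • leftShift)) *
        toCalkin ℂ EllTwo (cut rightProj (w₂ • 1 + z₂ • ContinuousLinearMap.adjoint leftShift))) := by
  have h := isShiftCut_rightProj
  have hc (c d : ℂ) : Commute (toCalkin ℂ EllTwo rightProj)
      (toCalkin ℂ EllTwo (c • 1 + d • leftShift)) := by
    simp only [map_add, map_smul, map_one]
    exact ((Commute.one_right _).smul_right c).add_right (h.commute.smul_right d)
  have hc' (c d : ℂ) : Commute (toCalkin ℂ EllTwo rightProj)
      (toCalkin ℂ EllTwo (c • 1 + d • ContinuousLinearMap.adjoint leftShift)) := by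
    simp only [map_add, map_smul, map_one]
    exact ((Commute.one_right _).smul_right c).add_right (h.commute_inv.smul_right d)
  have hq : (1 - toCalkin ℂ EllTwo rightProj) * (1 - toCalkin ℂ EllTwo rightProj) =
      1 - toCalkin ℂ EllTwo rightProj := by
    simp [mul_sub, sub_mul, h.toCalkin_idem]
  have hp (x y z w : ℂ) : toCalkin ℂ EllTwo (y • 1 + x • leftShift) *
      toCalkin ℂ EllTwo (w • 1 + z • ContinuousLinearMap.adjoint leftShift) =
      algebraMap ℂ _ (x * w) * toCalkin ℂ EllTwo leftShift + algebraMap ℂ _ (y * w + x * z) +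
        algebraMap ℂ _ (y * z) * toCalkin ℂ EllTwo (ContinuousLinearMap.adjoint leftShift) := by
    have h₁ : toCalkin ℂ EllTwo leftShift *
        toCalkin ℂ EllTwo (ContinuousLinearMap.adjoint leftShift) = 1 := by
      rw [← map_mul, h.mul_inv, map_one]
    rw [← Algebra.smul_def, ← Algebra.smul_def, Algebra.algebraMap_eq_smul_one]
    simp only [map_add, map_smul, map_one, mul_add, add_mul, smul_mul_assoc, mul_smul_comm, one_mul,
      mul_one, h₁]
    module
  simp only [map_cut, map_sub, map_one]
  rw [cut_mul_cut hq ((Commute.one_left _).sub_left (hc _ _)), cut_mul_cut h.toCalkin_idem (hc _ _),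
    cut_compl_mul_cut h.toCalkin_idem ((hc _ _).mul_right (hc' _ _)), hp, hp, map_add, map_add,
    map_mul, map_mul, toCalkin_eq_of_diagonal hA ha₁ ha₂, toCalkin_eq_of_diagonal hB hb₁ hb₂,
    toCalkin_eq_of_diagonal hG hg₁ hg₂]
  noncomm_ring

/-- Fredholm criterion and index formula for a Jacobi operator whose coefficients have limits and
whose limits are factored into operators of first order. -/
theorem isFredholm_and_index_jacobi (hA : ∀ f n, A f n = a n * f n) (hB : ∀ f n, B f n = b n * f n)
    (hG : ∀ f n, G f n = g n * f n)
    {x₁ y₁ z₁ w₁ x₂ y₂ z₂ w₂ : ℂ}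
    (ha₁ : Tendsto a atBot (𝓝 (x₁ * w₁))) (ha₂ : Tendsto a atTop (𝓝 (x₂ * w₂)))
    (hb₁ : Tendsto b atBot (𝓝 (y₁ * w₁ + x₁ * z₁))) (hb₂ : Tendsto b atTop (𝓝 (y₂ * w₂ + x₂ * z₂)))
    (hg₁ : Tendsto g atBot (𝓝 (y₁ * z₁))) (hg₂ : Tendsto g atTop (𝓝 (y₂ * z₂)))
    {T : EllTwo →L[ℂ] EllTwo}
    (hT : T = A * leftShift + B + G * ContinuousLinearMap.adjoint leftShift) :
    (T.IsFredholm ↔ (‖x₁‖ ≠ ‖y₁‖ ∧ ‖z₁‖ ≠ ‖w₁‖) ∧ (‖x₂‖ ≠ ‖y₂‖ ∧ ‖z₂‖ ≠ ‖w₂‖)) ∧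
      (T.IsFredholm → T.toLinearMap.index =
        ((if ‖x₁‖ < ‖y₁‖ then 0 else -1) + (if ‖z₁‖ < ‖w₁‖ then 0 else 1)) +
          ((if ‖x₂‖ < ‖y₂‖ then 0 else 1) + (if ‖z₂‖ < ‖w₂‖ then 0 else -1))) := by
  have hπ := toCalkin_jacobi hA hB hG ha₁ ha₂ hb₁ hb₂ hg₁ hg₂
  rw [← hT] at hπ
  have hr := isShiftCut_rightProj
  have hl := isShiftCut_leftProj
  have ir := index_cut_rightProj
  have il := index_cut_leftProj
  have ir' := hr.index_cut_inv
  have il' := hl.index_cut_inv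
  rw [ir] at ir'
  rw [il, neg_neg] at il'
  set F₁ := cut (1 - rightProj) (y₁ • 1 + x₁ • leftShift) with hF₁
  set F₂ := cut (1 - rightProj) (w₁ • 1 + z₁ • ContinuousLinearMap.adjoint leftShift) with hF₂
  set F₃ := cut rightProj (y₂ • 1 + x₂ • leftShift) with hF₃
  set F₄ := cut rightProj (w₂ • 1 + z₂ • ContinuousLinearMap.adjoint leftShift) with hF₄
  have hcomm : Commute (toCalkin ℂ EllTwo leftShift)
      (toCalkin ℂ EllTwo (ContinuousLinearMap.adjoint leftShift)) := by
    rw [Commute, SemiconjBy, ← map_mul, ← map_mul, hr.mul_inv, hr.inv_mul]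
  have hlin {S S' : Calkin ℂ EllTwo} (hS : Commute S S') (c d c' d' : ℂ) :
      Commute (c • 1 + d • S) (c' • 1 + d' • S') :=
    ((((Commute.one_left _).smul_left c).add_left ((Commute.one_right S).smul_left d)).smul_right
      c').add_right ((((Commute.one_left _).smul_left c).add_left (hS.smul_left d)).smul_right d')
  have hone {S p : Calkin ℂ EllTwo} (hS : Commute p S) (c d : ℂ) : Commute p (c • 1 + d • S) :=
    ((Commute.one_right _).smul_right c).add_right (hS.smul_right d)
  have key {p p' S S' : Calkin ℂ EllTwo} (h₁ : Commute p p') (h₂ : Commute p S')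
      (h₃ : Commute p' S) (h₄ : Commute S S') (c d c' d' : ℂ) :
      Commute (cut p (c • 1 + d • S)) (cut p' (c' • 1 + d' • S')) :=
    h₁.cut (hone h₂ c' d') (hone h₃ c d).symm (hlin h₄ c d c' d')
  have hpp : Commute (toCalkin ℂ EllTwo (1 - rightProj)) (toCalkin ℂ EllTwo rightProj) := by
    rw [map_sub, map_one]
    exact (Commute.one_left _).sub_left (Commute.refl _)
  have c₁₂ : Commute (toCalkin ℂ EllTwo F₁) (toCalkin ℂ EllTwo F₂) := by
    simp only [hF₁, hF₂, map_cut (toCalkin ℂ EllTwo), map_add, map_smul, map_one]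
    exact key (Commute.refl _) hl.commute_inv hl.commute hcomm _ _ _ _
  have c₃₄ : Commute (toCalkin ℂ EllTwo F₃) (toCalkin ℂ EllTwo F₄) := by
    simp only [hF₃, hF₄, map_cut (toCalkin ℂ EllTwo), map_add, map_smul, map_one]
    exact key (Commute.refl _) hr.commute_inv hr.commute hcomm _ _ _ _
  have c₁₃ : Commute (toCalkin ℂ EllTwo F₁) (toCalkin ℂ EllTwo F₃) := by
    simp only [hF₁, hF₃, map_cut (toCalkin ℂ EllTwo), map_add, map_smul, map_one]
    exact key hpp hl.commute hr.commute (Commute.refl _) _ _ _ _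
  have c₁₄ : Commute (toCalkin ℂ EllTwo F₁) (toCalkin ℂ EllTwo F₄) := by
    simp only [hF₁, hF₄, map_cut (toCalkin ℂ EllTwo), map_add, map_smul, map_one]
    exact key hpp hl.commute_inv hr.commute hcomm _ _ _ _
  have c₂₃ : Commute (toCalkin ℂ EllTwo F₂) (toCalkin ℂ EllTwo F₃) := by
    simp only [hF₂, hF₃, map_cut (toCalkin ℂ EllTwo), map_add, map_smul, map_one]
    exact key hpp hl.commute hr.commute_inv hcomm.symm _ _ _ _
  have c₂₄ : Commute (toCalkin ℂ EllTwo F₂) (toCalkin ℂ EllTwo F₄) := by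
    simp only [hF₂, hF₄, map_cut (toCalkin ℂ EllTwo), map_add, map_smul, map_one]
    exact key hpp hl.commute_inv hr.commute_inv (Commute.refl _) _ _ _ _
  -- A product of commuting elements is a unit exactly when every factor is; this is why all pairs
  -- were shown to commute.
  have hfac : T.IsFredholm ↔ (F₁.IsFredholm ∧ F₂.IsFredholm) ∧ (F₃.IsFredholm ∧ F₄.IsFredholm) := by
    simp only [isFredholm_iff_isUnit_toCalkin, hπ]
    rw [((c₁₃.mul_left c₂₃).mul_right (c₁₄.mul_left c₂₄)).isUnit_mul_iff, c₁₂.isUnit_mul_iff,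
      c₃₄.isUnit_mul_iff]
  have n₁ := fun h => hl.norm_ne_of_isFredholm (x := x₁) (y := y₁) (by rw [il]; norm_num) h
  have n₂ := fun h => hl.inv.norm_ne_of_isFredholm (x := z₁) (y := w₁) (by rw [il']; norm_num) h
  have n₃ := fun h => hr.norm_ne_of_isFredholm (x := x₂) (y := y₂) (by rw [ir]; norm_num) h
  have n₄ := fun h => hr.inv.norm_ne_of_isFredholm (x := z₂) (y := w₂) (by rw [ir']; norm_num) h
  refine ⟨hfac.trans ?_, fun hF => ?_⟩
  · constructor
    · rintro ⟨⟨h₁, h₂⟩, h₃, h₄⟩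
      exact ⟨⟨n₁ h₁, n₂ h₂⟩, n₃ h₃, n₄ h₄⟩
    · rintro ⟨⟨h₁, h₂⟩, h₃, h₄⟩
      exact ⟨⟨(hl.isFredholm_and_index h₁).1, (hl.inv.isFredholm_and_index h₂).1⟩,
        (hr.isFredholm_and_index h₃).1, (hr.inv.isFredholm_and_index h₄).1⟩
  · obtain ⟨⟨h₁, h₂⟩, h₃, h₄⟩ := hfac.1 hF
    have i₁ := (hl.isFredholm_and_index (n₁ h₁)).2
    have i₂ := (hl.inv.isFredholm_and_index (n₂ h₂)).2
    have i₃ := (hr.isFredholm_and_index (n₃ h₃)).2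
    have i₄ := (hr.inv.isFredholm_and_index (n₄ h₄)).2
    rw [il] at i₁
    rw [il'] at i₂
    rw [ir] at i₃
    rw [ir'] at i₄
    -- The factorization holds only modulo the ideal, but the index depends only on the class.
    have hprod := hF.index_congr (g := (F₁ ∘L F₂) ∘L (F₃ ∘L F₄)) (by
      rw [hπ, ← map_mul, ← map_mul, ← map_mul]
      rfl)
    rw [← hprod, (h₁.comp h₂).index_comp (h₃.comp h₄), h₁.index_comp h₂, h₃.index_comp h₄, i₁, i₂,
      i₃, i₄]

end

/-! ### The Witten index as the index of `Q₊`. -/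

noncomputable section

open ContinuousLinearMap

namespace SUSYQW

variable {H : Type*} [NormedAddCommGroup H] [InnerProductSpace ℂ H] [CompleteSpace H]

theorem isSelfAdjoint_of_unitary_of_involution {A : H →L[ℂ] H} (hu : A ∈ unitary (H →L[ℂ] H))
    (hi : A * A = 1) : IsSelfAdjoint A := by
  have h := Unitary.star_mul_self_of_mem hu
  calc star A = star A * (A * A) := by rw [hi, mul_one]
    _ = A := by rw [← mul_assoc, h, one_mul]

theorem isSelfAdjoint_supercharge (S : SUSYQW H) : IsSelfAdjoint S.supercharge := by
  have hΓ := (isSelfAdjoint_of_unitary_of_involution S.Γ_unitary S.Γ_involution).star_eq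
  have hC := (isSelfAdjoint_of_unitary_of_involution S.C_unitary S.C_involution).star_eq
  have h : star ((2 * Complex.I)⁻¹ : ℂ) = -(2 * Complex.I)⁻¹ := by simp
  rw [IsSelfAdjoint, supercharge, star_smul, star_sub, star_mul, star_mul, hΓ, hC, h, neg_smul,
    ← smul_neg, neg_sub]

theorem inner_supercharge (S : SUSYQW H) (u v : H) :
    inner ℂ (S.supercharge u) v = inner ℂ u (S.supercharge v) := by
  rw [← ContinuousLinearMap.adjoint_inner_right,
    (ContinuousLinearMap.isSelfAdjoint_iff'.1 S.isSelfAdjoint_supercharge)]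

/-- `⟨Qv, Qv⟩ = ⟨v, Q²v⟩` by self-adjointness. -/
theorem supercharge_eq_zero_iff (S : SUSYQW H) {v : H} :
    S.superhamiltonian v = 0 ↔ S.supercharge v = 0 := by
  constructor
  · intro h
    rw [← inner_self_eq_zero (𝕜 := ℂ), inner_supercharge]
    exact (congrArg (inner ℂ v) h).trans (inner_zero_right v)
  · intro h
    exact (congrArg S.supercharge h).trans (map_zero _)

theorem ker_hamiltonianPlus (S : SUSYQW H) :
    S.hamiltonianPlus.ker = S.superchargePlus.toLinearMap.ker := by
  ext v
  rw [LinearMap.mem_ker, LinearMap.mem_ker, Subtype.ext_iff, Subtype.ext_iff]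
  exact S.supercharge_eq_zero_iff

instance (S : SUSYQW H) : CompleteSpace S.minusSpace :=
  (S.Γ + 1).isClosed_ker.completeSpace_coe

theorem ker_hamiltonianMinus (S : SUSYQW H) :
    S.hamiltonianMinus.ker = S.superchargePlus.toLinearMap.rangeᗮ := by
  ext v
  rw [LinearMap.mem_ker, Subtype.ext_iff, Submodule.mem_orthogonal]
  refine S.supercharge_eq_zero_iff.trans ⟨?_, fun h => ?_⟩
  · rintro h _ ⟨u, rfl⟩
    exact (S.inner_supercharge u v).trans ((congrArg _ h).trans (inner_zero_right _))
  -- Testing orthogonality against `Q₊(Qv)` gives `‖Qv‖² = 0`.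
  · have := h _ ⟨⟨S.supercharge v, S.supercharge_minus v v.2⟩, rfl⟩
    rw [← inner_self_eq_zero (𝕜 := ℂ), ← inner_supercharge]
    exact this

/-- If `Q₊` is Fredholm, then the Witten index is well defined and is the index of `Q₊`. -/
theorem IsFredholm.wittenIndex {S : SUSYQW H} (h : S.IsFredholm) :
    S.HasWittenIndex ∧ S.wittenIndex = S.superchargePlus.toLinearMap.index := by
  have hF : S.superchargePlus.IsFredholm := h
  have hc := hF.isClosed_range.completeSpace_coe
  have hfin : FiniteDimensional ℂ (S.minusSpace ⧸ S.superchargePlus.toLinearMap.range) :=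
    hF.finite_coker
  have hfin' := hF.finite_ker
  -- The range of a Fredholm operator is closed, so its orthogonal complement, the kernel of `H₋`,
  -- is a model of the cokernel.
  let e := Submodule.quotientEquivOfIsCompl _ _
    (Submodule.isCompl_orthogonal
      (K := S.superchargePlus.toLinearMap.range))
  rw [HasWittenIndex, SUSYQW.wittenIndex, ker_hamiltonianPlus, ker_hamiltonianMinus,
    LinearMap.index_eq_finrank_sub, e.finrank_eq]
  exact ⟨⟨hfin', e.finiteDimensional⟩, rfl⟩

end SUSYQW

end

/-! ### Coordinates on the eigenspaces of `Γ`, and the limit coins. -/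

noncomputable section

open ContinuousLinearMap

namespace SUSYQW

variable {H X : Type*} [NormedAddCommGroup H] [InnerProductSpace ℂ H] [CompleteSpace H]
  [NormedAddCommGroup X] [NormedSpace ℂ X]

/-- If `Jp`, `Jm` parametrize the eigenspaces of `Γ`, with left inverses `Kp`, `Km` annihilating the
complementary eigenspaces, then `Q₊` corresponds to `Km C Jp` up to a unimodular factor. -/
theorem isFredholm_iff_and_index_eq (S : SUSYQW H) {Jp Jm : X →L[ℂ] H} {Kp Km : H →L[ℂ] X}
    (hp : ∀ f, Kp (Jp f) = f) (hm : ∀ f, Km (Jm f) = f)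
    (hΓp : ∀ v, (2 : ℂ) • Jp (Kp v) = v + S.Γ v) (hΓm : ∀ v, (2 : ℂ) • Jm (Km v) = v - S.Γ v) :
    (S.IsFredholm ↔ (Km ∘L S.C ∘L Jp).IsFredholm) ∧ ((Km ∘L S.C ∘L Jp).IsFredholm →
      S.superchargePlus.toLinearMap.index = (Km ∘L S.C ∘L Jp).toLinearMap.index) := by
  have ep (f : X) : S.Γ (Jp f) = Jp f := by
    have := hΓp (Jp f)
    rw [hp, two_smul] at this
    exact (add_left_cancel this).symm
  have em (f : X) : S.Γ (Jm f) = -Jm f := by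
    have := hΓm (Jm f)
    rw [hm, two_smul, sub_eq_add_neg] at this
    exact neg_eq_iff_eq_neg.1 (add_left_cancel this).symm
  let Ep : X ≃L[ℂ] S.plusSpace := .equivOfInverse
    (Jp.codRestrict S.plusSpace fun f => S.mem_plusSpace.2 (ep f)) (Kp ∘L S.plusSpace.subtypeL)
    hp (fun v => by
      refine Subtype.ext ?_
      have := hΓp v
      rw [S.mem_plusSpace.1 v.2, ← two_smul ℂ] at this
      exact smul_right_injective H (two_ne_zero (α := ℂ)) this)
  -- On `ker (Γ - 1)`, `Q = -(1 - Γ)C/(2i) = i Jm Km C`; putting the factor `i` into `Em` makes the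
  -- square commute exactly.
  let Em : X ≃L[ℂ] S.minusSpace := .equivOfInverse
    ((Complex.I • Jm).codRestrict S.minusSpace fun f => S.mem_minusSpace.2 (by simp [em f]))
    ((-Complex.I • Km) ∘L S.minusSpace.subtypeL)
    (fun f => by simp [hm f, smul_smul]) (fun v => by
      refine Subtype.ext ?_
      have := hΓm v
      rw [S.mem_minusSpace.1 v.2, sub_neg_eq_add, ← two_smul ℂ] at this
      have := smul_right_injective H (two_ne_zero (α := ℂ)) this
      simpa [smul_smul] using this)
  have hcomm : S.superchargePlus ∘L (Ep : X →L[ℂ] S.plusSpace) =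
      (Em : X →L[ℂ] S.minusSpace) ∘L (Km ∘L S.C ∘L Jp) := by
    ext f
    have h₁ : (2 * Complex.I)⁻¹ • (S.Γ (S.C (Jp f)) - S.C (S.Γ (Jp f))) =
        Complex.I • Jm (Km (S.C (Jp f))) := by
      have h₂ : S.Γ (S.C (Jp f)) - S.C (S.Γ (Jp f)) = -((2 : ℂ) • Jm (Km (S.C (Jp f)))) := by
        rw [hΓm, ep]
        abel
      rw [h₂, ← smul_neg, smul_smul, smul_neg, ← neg_smul]
      congr 1
      rw [mul_inv, Complex.inv_I]
      ring
    exact h₁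
  have hF : S.IsFredholm ↔ (Km ∘L S.C ∘L Jp).IsFredholm := by
    rw [← isFredholm_equiv_comp_iff Em, ← hcomm, isFredholm_comp_equiv_iff]
    rfl
  refine ⟨hF, fun hT => ?_⟩
  have hQ : S.superchargePlus.IsFredholm := hF.2 hT
  have i₁ := hQ.index_comp Ep.isFredholm
  have i₂ := Em.isFredholm.index_comp hT
  have j₁ : (Ep : X →L[ℂ] S.plusSpace).toLinearMap.index = 0 :=
    LinearEquiv.index_eq_zero (e := Ep.toLinearEquiv)
  have j₂ : (Em : X →L[ℂ] S.minusSpace).toLinearMap.index = 0 :=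
    LinearEquiv.index_eq_zero (e := Em.toLinearEquiv)
  rw [hcomm, i₂, j₁, j₂] at i₁
  omega

end SUSYQW

namespace SplitStep

/-- The map `f ↦ (α L f, β f)`. -/
def embed (α β : ℂ) : EllTwo →L[ℂ] StateSpace :=
  (WithLp.prodContinuousLinearEquiv 2 ℂ EllTwo EllTwo).symm.toContinuousLinearMap ∘L
    ((α • leftShift).prod (β • 1))

/-- The map `v ↦ α L* v₁ + β v₂`. -/
def coembed (α β : ℂ) : StateSpace →L[ℂ] EllTwo :=
  ((α • ContinuousLinearMap.adjoint leftShift).coprod (β • 1)) ∘L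
    (WithLp.prodContinuousLinearEquiv 2 ℂ EllTwo EllTwo).toContinuousLinearMap

theorem embed_fst (α β : ℂ) (f : EllTwo) (x : ℤ) : (embed α β f).fst x = α * f (x + 1) := rfl

theorem embed_snd (α β : ℂ) (f : EllTwo) (x : ℤ) : (embed α β f).snd x = β * f x := rfl

theorem coembed_apply (α β : ℂ) (v : StateSpace) (x : ℤ) :
    coembed α β v x = α * v.fst (x - 1) + β * v.snd x := by
  have h : coembed α β v x =
    α * ContinuousLinearMap.adjoint leftShift v.fst x + β * v.snd x := rfl
  rw [h, adjoint_leftShift_apply]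

theorem stateSpace_ext {v w : StateSpace} (h₁ : ∀ x, v.fst x = w.fst x)
    (h₂ : ∀ x, v.snd x = w.snd x) : v = w :=
  WithLp.ofLp_injective 2 (Prod.ext (lp.ext (funext h₁)) (lp.ext (funext h₂)))

theorem shiftOp_fst (W : SplitStep) (v : StateSpace) (x : ℤ) :
    (W.shiftOp v).fst x = W.p * v.fst x + W.q * v.snd (x + 1) := rfl

theorem shiftOp_snd (W : SplitStep) (v : StateSpace) (x : ℤ) :
    (W.shiftOp v).snd x = conj W.q * v.fst (x - 1) - W.p * v.snd x := by
  have h : (W.shiftOp v).snd x =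
    conj W.q * ContinuousLinearMap.adjoint leftShift v.fst x + -W.p * v.snd x := rfl
  rw [h, adjoint_leftShift_apply]
  ring

theorem coinOp_fst (W : SplitStep) (v : StateSpace) (x : ℤ) :
    (W.coinOp v).fst x = W.a₁ x * v.fst x + conj (W.b x) * v.snd x := by
  simp [coinOp, -lp.coeFn_add, ellTwo_add_apply]

theorem coinOp_snd (W : SplitStep) (v : StateSpace) (x : ℤ) :
    (W.coinOp v).snd x = W.b x * v.fst x + W.a₂ x * v.snd x := by
  simp [coinOp, -lp.coeFn_add, ellTwo_add_apply]

/-- Half-angle parameters of the shift operator. -/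
theorem exists_halfAngle (W : SplitStep) : ∃ (c s : ℝ) (e : ℂ), 0 ≤ c ∧ 0 ≤ s ∧
    2 * c ^ 2 = 1 + W.p ∧ 2 * s ^ 2 = 1 - W.p ∧ W.q = 2 * c * s * e ∧ ‖e‖ = 1 := by
  have hp : W.p ^ 2 ≤ 1 := by nlinarith [W.shift_cond, sq_nonneg ‖W.q‖]
  obtain ⟨h₁, h₂⟩ := abs_le.1 ((sq_le_one_iff_abs_le_one _).1 hp)
  have hc : √((1 + W.p) / 2) ^ 2 = (1 + W.p) / 2 := Real.sq_sqrt (by linarith)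
  have hs : √((1 - W.p) / 2) ^ 2 = (1 - W.p) / 2 := Real.sq_sqrt (by linarith)
  have hq : ‖W.q‖ = 2 * √((1 + W.p) / 2) * √((1 - W.p) / 2) := by
    rw [← sq_eq_sq₀ (norm_nonneg _) (by positivity), mul_pow, mul_pow, hc, hs]
    linarith [W.shift_cond]
  -- The exponential of the argument is unimodular even when `q = 0`, so this case needs no separate
  -- treatment.
  obtain ⟨e, he, heq⟩ : ∃ e : ℂ, ‖e‖ = 1 ∧ W.q = ‖W.q‖ * e :=
    ⟨Complex.exp (W.q.arg * Complex.I), Complex.norm_exp_ofReal_mul_I _,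
      (Complex.norm_mul_exp_arg_mul_I _).symm⟩
  refine ⟨_, _, e, Real.sqrt_nonneg _, Real.sqrt_nonneg _, by rw [hc]; ring, by rw [hs]; ring, ?_, he⟩
  rw [heq, hq]
  push_cast
  rfl

/-- The limit of the coins, in the parametrization by which the limiting Jacobi operators factor. -/
theorem exists_limit (W : SplitStep) {l : Filter ℤ} [l.NeBot] {M : Matrix (Fin 2) (Fin 2) ℂ}
    (hl : Tendsto W.coinAt l (𝓝 M)) (h₁ : M ≠ 1) (h₂ : M ≠ -1) {a : ℝ} (ha : (a : ℂ) = M 0 0)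
    {e : ℂ} (he : ‖e‖ = 1) :
    Tendsto (fun x => (W.a₁ x : ℂ)) l (𝓝 a) ∧ Tendsto (fun x => (W.a₂ x : ℂ)) l (𝓝 (-a)) ∧
      ∃ (r t : ℝ) (u : ℂ), 0 ≤ r ∧ 0 ≤ t ∧ r ^ 2 = 1 + a ∧ t ^ 2 = 1 - a ∧ ‖u‖ = 1 ∧
        Tendsto (fun x => e * W.b x) l (𝓝 (r * t * u)) := by
  have hM (i j : Fin 2) : Tendsto (fun x => W.coinAt x i j) l (𝓝 (M i j)) :=
    tendsto_pi_nhds.1 (tendsto_pi_nhds.1 hl i) j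
  have ha₁ : Tendsto (fun x => (W.a₁ x : ℂ)) l (𝓝 a) := by
    rw [ha]
    exact hM 0 0
  have ha₂ : Tendsto (fun x => (W.a₂ x : ℂ)) l (𝓝 (M 1 1)) := hM 1 1
  have hb : Tendsto W.b l (𝓝 (M 1 0)) := hM 1 0
  have hb' : Tendsto (fun x => conj (W.b x)) l (𝓝 (M 0 1)) := hM 0 1
  have hconj : M 0 1 = conj (M 1 0) :=
    tendsto_nhds_unique hb' ((Complex.continuous_conj.tendsto _).comp hb)
  have ra₁ : Tendsto W.a₁ l (𝓝 a) := (Complex.continuous_re.tendsto _).comp ha₁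
  have ra₂ : Tendsto W.a₂ l (𝓝 (M 1 1).re) := (Complex.continuous_re.tendsto _).comp ha₂
  have h11 : M 1 1 = ((M 1 1).re : ℂ) :=
    tendsto_nhds_unique ha₂ ((Complex.continuous_ofReal.tendsto _).comp ra₂)
  have e₁ : a ^ 2 + ‖M 1 0‖ ^ 2 = 1 :=
    tendsto_nhds_unique (((ra₁.pow 2).add (hb.norm.pow 2)).congr W.coin_cond₁) tendsto_const_nhds
  have e₂ : (M 1 1).re ^ 2 + ‖M 1 0‖ ^ 2 = 1 :=
    tendsto_nhds_unique (((ra₂.pow 2).add (hb.norm.pow 2)).congr W.coin_cond₂) tendsto_const_nhds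
  have e₃ : M 1 0 * (a + M 1 1) = 0 :=
    tendsto_nhds_unique ((hb.mul (ha₁.add ha₂)).congr W.coin_cond₃) tendsto_const_nhds
  -- Nontriviality enters here: a nonzero trace would force the off-diagonal entries to vanish and
  -- both diagonal entries to be the same sign `±1`, so that `M = ±1`.
  have e₄ : (M 1 1).re = -a := by
    by_contra hne
    have hb0 : M 1 0 = 0 := by
      refine (mul_eq_zero.1 e₃).resolve_right fun h => hne ?_
      rw [h11] at h
      have : a + (M 1 1).re = 0 := by exact_mod_cast h
      linarith
    have h3 : (M 1 1).re = a := by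
      have : ((M 1 1).re - a) * ((M 1 1).re + a) = 0 := by linear_combination e₂ - e₁
      rcases mul_eq_zero.1 this with h | h
      · linarith
      · exact absurd (by linarith) hne
    rw [hb0, norm_zero] at e₁
    have h4 : M = !![(a : ℂ), 0; 0, (a : ℂ)] := by
      ext i j
      fin_cases i <;> fin_cases j
      · exact ha.symm
      · simp [hconj, hb0]
      · simp [hb0]
      · simp only [Fin.mk_one, Matrix.of_apply, Matrix.cons_val]
        rw [h11, h3]
    have h5 : (a - 1) * (a + 1) = 0 := by linear_combination e₁
    rcases mul_eq_zero.1 h5 with h | h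
    · apply h₁
      rw [h4, show a = 1 by linarith, Matrix.one_fin_two]
      simp
    · apply h₂
      rw [h4, show a = -1 by linarith, Matrix.one_fin_two]
      simp
  rw [h11, e₄, Complex.ofReal_neg] at ha₂
  obtain ⟨h6, h7⟩ := abs_le.1 ((sq_le_one_iff_abs_le_one a).1 (by nlinarith [sq_nonneg ‖M 1 0‖]))
  have hr : √(1 + a) ^ 2 = 1 + a := Real.sq_sqrt (by linarith)
  have ht : √(1 - a) ^ 2 = 1 - a := Real.sq_sqrt (by linarith)
  have hn : ‖e * M 1 0‖ = √(1 + a) * √(1 - a) := by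
    rw [norm_mul, he, one_mul, ← sq_eq_sq₀ (norm_nonneg _) (by positivity), mul_pow, hr, ht]
    linarith
  refine ⟨ha₁, ha₂, _, _, Complex.exp ((e * M 1 0).arg * Complex.I), Real.sqrt_nonneg _,
    Real.sqrt_nonneg _, hr, ht, Complex.norm_exp_ofReal_mul_I _, ?_⟩
  rw [← Complex.ofReal_mul, ← hn, Complex.norm_mul_exp_arg_mul_I]
  exact hb.const_mul e

end SplitStep

end

/-! ### Thresholds and the index formula. -/

noncomputable section

open ContinuousLinearMap

/-- Both products are nonnegative and `(sr)² - (ct)² = a - p`. Exchanging `c` and `s` replaces `p`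
by `-p`, which covers the second factor. -/
theorem threshold_iff {p a c s r t : ℝ} (hc : 0 ≤ c) (hs : 0 ≤ s)
    (hr : 0 ≤ r) (ht : 0 ≤ t) (hcp : 2 * c ^ 2 = 1 + p) (hsp : 2 * s ^ 2 = 1 - p)
    (hra : r ^ 2 = 1 + a) (hta : t ^ 2 = 1 - a) :
    (c * t < s * r ↔ p < a) ∧ (c * t = s * r ↔ p = a) := by
  have h : (s * r) ^ 2 - (c * t) ^ 2 = a - p := by
    rw [mul_pow, mul_pow, hra, hta]
    linear_combination (1 + a) / 2 * hsp - (1 - a) / 2 * hcp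
  constructor
  · rw [← sq_lt_sq₀ (by positivity) (by positivity)]
    constructor <;> intro _ <;> linarith
  · rw [← sq_eq_sq₀ (by positivity) (by positivity)]
    constructor <;> intro _ <;> linarith

/-- The contribution of the right end: for `|a| > |p|` the two factors contribute nothing or cancel,
and for `|a| < |p|` exactly one of them contributes. -/
theorem threshold_sum {p a : ℝ} (h : |p| ≠ |a|) :
    ((if p < a then 0 else 1) + (if -p < a then 0 else -1) : ℤ) =
      if |a| < |p| then ((SignType.sign p : SignType) : ℤ) else 0 := by
  rcases lt_trichotomy p 0 with hp | rfl | hp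
  · rw [sign_neg hp]
    rw [abs_of_neg hp] at *
    rcases lt_or_gt_of_ne h with ha | ha
    · rw [if_neg ha.not_gt]
      rcases lt_abs.1 ha with h' | h'
      · rw [if_pos (by linarith), if_pos (by linarith)]
        rfl
      · rw [if_neg (by linarith), if_neg (by linarith)]
        rfl
    · obtain ⟨h₁, h₂⟩ := abs_lt.1 ha
      rw [if_pos (by linarith), if_neg (by linarith), if_pos ha]
      rfl
  · rw [abs_zero] at *
    have ha : 0 < |a| := lt_of_le_of_ne (abs_nonneg a) h
    rw [if_neg ha.not_gt, neg_zero]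
    split_ifs <;> rfl
  · rw [sign_pos hp]
    rw [abs_of_pos hp] at *
    rcases lt_or_gt_of_ne h with ha | ha
    · rw [if_neg ha.not_gt]
      rcases lt_abs.1 ha with h' | h'
      · rw [if_pos (by linarith), if_pos (by linarith)]
        rfl
      · rw [if_neg (by linarith), if_neg (by linarith)]
        rfl
    · obtain ⟨h₁, h₂⟩ := abs_lt.1 ha
      rw [if_neg (by linarith), if_pos (by linarith), if_pos ha]
      rfl

namespace SplitStep

theorem isFredholm_and_index (W : SplitStep) {CL CR : Matrix (Fin 2) (Fin 2) ℂ}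
    (hL : Tendsto W.coinAt atBot (𝓝 CL)) (hR : Tendsto W.coinAt atTop (𝓝 CR))
    (hL_nontrivial : CL ≠ 1 ∧ CL ≠ -1) (hR_nontrivial : CR ≠ 1 ∧ CR ≠ -1)
    {aL aR : ℝ} (haL : (aL : ℂ) = CL 0 0) (haR : (aR : ℂ) = CR 0 0) :
    (W.toSUSYQW.IsFredholm ↔ (W.p ≠ aL ∧ -W.p ≠ aL) ∧ (W.p ≠ aR ∧ -W.p ≠ aR)) ∧
      (W.toSUSYQW.IsFredholm → W.toSUSYQW.superchargePlus.toLinearMap.index =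
        ((if W.p < aL then 0 else -1) + (if -W.p < aL then 0 else 1)) +
          ((if W.p < aR then 0 else 1) + (if -W.p < aR then 0 else -1))) := by
  obtain ⟨c, s, e, hc, hs, hcp, hsp, hq, he⟩ := W.exists_halfAngle
  obtain ⟨hLa₁, hLa₂, rL, tL, uL, hrL, htL, hrL', htL', huL, hLb⟩ :=
    W.exists_limit hL hL_nontrivial.1 hL_nontrivial.2 haL he
  obtain ⟨hRa₁, hRa₂, rR, tR, uR, hrR, htR, hrR', htR', huR, hRb⟩ :=
    W.exists_limit hR hR_nontrivial.1 hR_nontrivial.2 haR he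
  have hunit {z : ℂ} (hz : ‖z‖ = 1) : z * conj z = 1 := by
    rw [Complex.mul_conj, Complex.normSq_eq_norm_sq, hz]
    norm_num
  have hee := hunit he
  have hcp' : 2 * (c : ℂ) ^ 2 = 1 + W.p := by exact_mod_cast hcp
  have hsp' : 2 * (s : ℂ) ^ 2 = 1 - W.p := by exact_mod_cast hsp
  have hq' : conj W.q = 2 * c * s * conj e := by
    simp only [hq, map_mul, Complex.conj_ofReal, map_ofNat]
  have hcs : (c : ℂ) ^ 2 + (s : ℂ) ^ 2 = 1 := by linear_combination (hcp' + hsp') / 2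
  have key := W.toSUSYQW.isFredholm_iff_and_index_eq (Jp := embed (c * e) s) (Jm := embed (-s * e) c)
    (Kp := coembed (c * conj e) s) (Km := coembed (-s * conj e) c)
    (fun f => lp.ext (funext fun x => by
      rw [coembed_apply, embed_fst, embed_snd, sub_add_cancel]
      linear_combination (f x) * hcs + c ^ 2 * f x * hee))
    (fun f => lp.ext (funext fun x => by
      rw [coembed_apply, embed_fst, embed_snd, sub_add_cancel]
      linear_combination (f x) * hcs + s ^ 2 * f x * hee))
    (fun v => stateSpace_ext
      (fun x => by
        have h : ((2 : ℂ) • embed (c * e) s (coembed (c * conj e) s v)).fst x =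
          2 * (embed (c * e) s (coembed (c * conj e) s v)).fst x := rfl
        have h' : (v + W.toSUSYQW.Γ v).fst x = v.fst x + (W.shiftOp v).fst x := rfl
        rw [h, h', embed_fst, coembed_apply, shiftOp_fst, add_sub_cancel_right, hq]
        linear_combination 2 * c ^ 2 * v.fst x * hee + v.fst x * hcp')
      (fun x => by
        have h : ((2 : ℂ) • embed (c * e) s (coembed (c * conj e) s v)).snd x =
          2 * (embed (c * e) s (coembed (c * conj e) s v)).snd x := rfl
        have h' : (v + W.toSUSYQW.Γ v).snd x = v.snd x + (W.shiftOp v).snd x := rfl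
        rw [h, h', embed_snd, coembed_apply, shiftOp_snd, hq']
        linear_combination v.snd x * hsp'))
    (fun v => stateSpace_ext
      (fun x => by
        have h : ((2 : ℂ) • embed (-s * e) c (coembed (-s * conj e) c v)).fst x =
          2 * (embed (-s * e) c (coembed (-s * conj e) c v)).fst x := rfl
        have h' : (v - W.toSUSYQW.Γ v).fst x = v.fst x - (W.shiftOp v).fst x := rfl
        rw [h, h', embed_fst, coembed_apply, shiftOp_fst, add_sub_cancel_right, hq]
        linear_combination 2 * s ^ 2 * v.fst x * hee + v.fst x * hsp')
      (fun x => by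
        have h : ((2 : ℂ) • embed (-s * e) c (coembed (-s * conj e) c v)).snd x =
          2 * (embed (-s * e) c (coembed (-s * conj e) c v)).snd x := rfl
        have h' : (v - W.toSUSYQW.Γ v).snd x = v.snd x - (W.shiftOp v).snd x := rfl
        rw [h, h', embed_snd, coembed_apply, shiftOp_snd, hq']
        linear_combination v.snd x * hcp'))
  set T : EllTwo →L[ℂ] EllTwo :=
    coembed (-s * conj e) c ∘L W.toSUSYQW.C ∘L embed (c * e) s
  let A : EllTwo →L[ℂ] EllTwo := ((c : ℂ) ^ 2 * e) • mulOp W.b W.norm_b_le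
  -- The argument `x - 1` in `a₁`, and likewise in `b` below, comes from the `L*` in `coembed`.
  let B : EllTwo →L[ℂ] EllTwo := ((c : ℂ) * s) •
    (mulOp (fun x => W.a₂ x) W.norm_a₂_le - mulOp (fun x => W.a₁ (x - 1)) fun x => W.norm_a₁_le _)
  let G : EllTwo →L[ℂ] EllTwo := (-(s : ℂ) ^ 2 * conj e) •
    mulOp (fun x => conj (W.b (x - 1))) fun x => W.norm_conj_b_le _
  have hA (f : EllTwo) (x : ℤ) : A f x = c ^ 2 * (e * W.b x) * f x := by
    simp only [A, ellTwo_op_smul_apply, mulOp_apply]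
    ring
  have hB (f : EllTwo) (x : ℤ) : B f x = c * s * (W.a₂ x - W.a₁ (x - 1)) * f x := by
    simp only [B, ellTwo_op_smul_apply, ellTwo_op_sub_apply, mulOp_apply]
    ring
  have hG (f : EllTwo) (x : ℤ) : G f x = -s ^ 2 * conj (e * W.b (x - 1)) * f x := by
    simp only [G, ellTwo_op_smul_apply, mulOp_apply, map_mul]
    ring
  have hT : T = A * leftShift + B + G * ContinuousLinearMap.adjoint leftShift := by
    ext f x
    have h₁ : T f x = coembed (-s * conj e) c (W.coinOp (embed (c * e) s f)) x := rfl
    rw [h₁, coembed_apply, coinOp_fst, coinOp_snd, embed_fst, embed_snd, embed_fst, embed_snd,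
      ellTwo_op_add_apply, ellTwo_op_add_apply, mul_apply_eq_comp, mul_apply_eq_comp, hA, hB, hG,
      leftShift_apply, adjoint_leftShift_apply, sub_add_cancel, map_mul]
    linear_combination (-s * c * W.a₁ (x - 1) * f x) * hee
  have hshift {l : Filter ℤ} {g : ℤ → ℂ} {z : ℂ} (hl : Tendsto (fun x : ℤ => x - 1) l l)
      (hg : Tendsto g l (𝓝 z)) : Tendsto (fun x => g (x - 1)) l (𝓝 z) := hg.comp hl
  have hbot : Tendsto (fun x : ℤ => x - 1) atBot atBot :=
    tendsto_atBot_add_const_right _ (-1) tendsto_id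
  have htop : Tendsto (fun x : ℤ => x - 1) atTop atTop :=
    tendsto_atTop_add_const_right _ (-1) tendsto_id
  -- The next three limits are the coefficients of `(ctu L - sr)(cr + stū L*)`. The constant term is
  -- `cs(t² - r²) = -2acs`.
  have limA {l : Filter ℤ} {r t : ℝ} {u : ℂ}
      (hb : Tendsto (fun x => e * W.b x) l (𝓝 (r * t * u))) :
      Tendsto (fun x => c ^ 2 * (e * W.b x)) l (𝓝 ((c * t * u) * (c * r))) := by
    convert hb.const_mul ((c : ℂ) ^ 2) using 2
    ring
  have limB {l : Filter ℤ} {a r t : ℝ} {u : ℂ} (hl : Tendsto (fun x : ℤ => x - 1) l l)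
      (ha₁ : Tendsto (fun x => (W.a₁ x : ℂ)) l (𝓝 a))
      (ha₂ : Tendsto (fun x => (W.a₂ x : ℂ)) l (𝓝 (-a))) (hr : r ^ 2 = 1 + a) (ht : t ^ 2 = 1 - a)
      (hu : ‖u‖ = 1) :
      Tendsto (fun x => (c * s * (W.a₂ x - W.a₁ (x - 1)) : ℂ)) l
        (𝓝 ((-s * r) * (c * r) + (c * t * u) * (s * t * conj u))) := by
    convert (ha₂.sub (hshift hl ha₁)).const_mul ((c : ℂ) * s) using 2
    have hr' : (r : ℂ) ^ 2 = 1 + a := by exact_mod_cast hr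
    have ht' : (t : ℂ) ^ 2 = 1 - a := by exact_mod_cast ht
    linear_combination c * s * t ^ 2 * hunit hu - c * s * hr' + c * s * ht'
  have limG {l : Filter ℤ} {r t : ℝ} {u : ℂ} (hl : Tendsto (fun x : ℤ => x - 1) l l)
      (hb : Tendsto (fun x => e * W.b x) l (𝓝 (r * t * u))) :
      Tendsto (fun x => -s ^ 2 * conj (e * W.b (x - 1))) l (𝓝 ((-s * r) * (s * t * conj u))) := by
    have h := (Complex.continuous_conj.tendsto _).comp (hshift hl hb)
    rw [map_mul, map_mul, Complex.conj_ofReal, Complex.conj_ofReal] at h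
    have hz : (-s * r) * (s * t * conj u) = -(s : ℂ) ^ 2 * (r * t * conj u) := by ring
    rw [hz]
    exact h.const_mul (-(s : ℂ) ^ 2)
  have hJ := isFredholm_and_index_jacobi hA hB hG (limA hLb) (limA hRb)
    (limB hbot hLa₁ hLa₂ hrL' htL' huL) (limB htop hRa₁ hRa₂ hrR' htR' huR)
    (limG hbot hLb) (limG htop hRb) hT
  have n₁ {t : ℝ} {u : ℂ} (ht : 0 ≤ t) (hu : ‖u‖ = 1) : ‖(c * t * u : ℂ)‖ = c * t := by
    simp [hu, abs_of_nonneg, hc, ht]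
  have n₂ {r : ℝ} (hr : 0 ≤ r) : ‖(-s * r : ℂ)‖ = s * r := by
    simp [abs_of_nonneg, hs, hr]
  have n₃ {t : ℝ} {u : ℂ} (ht : 0 ≤ t) (hu : ‖u‖ = 1) : ‖(s * t * conj u : ℂ)‖ = s * t := by
    simp [hu, abs_of_nonneg, hs, ht]
  have n₄ {r : ℝ} (hr : 0 ≤ r) : ‖(c * r : ℂ)‖ = c * r := by
    simp [abs_of_nonneg, hc, hr]
  have hcp'' : 2 * c ^ 2 = 1 - -W.p := by rw [hcp]; ring
  have th (a r t : ℝ) (hr : 0 ≤ r) (ht : 0 ≤ t) (hra : r ^ 2 = 1 + a) (hta : t ^ 2 = 1 - a) :=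
    threshold_iff hc hs hr ht hcp hsp hra hta
  have th' (a r t : ℝ) (hr : 0 ≤ r) (ht : 0 ≤ t) (hra : r ^ 2 = 1 + a) (hta : t ^ 2 = 1 - a) :=
    threshold_iff hs hc hr ht (p := -W.p) hsp hcp'' hra hta
  have tL₁ := th _ _ _ hrL htL hrL' htL'
  have tL₂ := th' _ _ _ hrL htL hrL' htL'
  have tR₁ := th _ _ _ hrR htR hrR' htR'
  have tR₂ := th' _ _ _ hrR htR hrR' htR'
  simp only [n₁ htL huL, n₁ htR huR, n₂ hrL, n₂ hrR, n₃ htL huL, n₃ htR huR, n₄ hrL, n₄ hrR,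
    ne_eq, tL₁, tL₂, tR₁, tR₂] at hJ
  refine ⟨key.1.trans hJ.1, fun hF => ?_⟩
  have hTF := key.1.1 hF
  exact (key.2 hTF).trans (hJ.2 hTF)

end SplitStep

end

theorem mainTheorem1 (W : SplitStep) (CL CR : Matrix (Fin 2) (Fin 2) ℂ)
    (hL : Tendsto W.coinAt atBot (𝓝 CL)) (hR : Tendsto W.coinAt atTop (𝓝 CR))
    (hL_nontrivial : CL ≠ 1 ∧ CL ≠ -1) (hR_nontrivial : CR ≠ 1 ∧ CR ≠ -1)
    (aL aR : ℝ) (haL : (aL : ℂ) = CL 0 0) (haR : (aR : ℂ) = CR 0 0) :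
    (W.toSUSYQW.IsFredholm ↔ |W.p| ≠ |aL| ∧ |W.p| ≠ |aR|) ∧
      (W.toSUSYQW.IsFredholm →
        W.toSUSYQW.HasWittenIndex ∧
          W.toSUSYQW.wittenIndex =
            if |aR| < |W.p| ∧ |W.p| < |aL| then ((SignType.sign W.p : SignType) : ℤ)
            else if |aL| < |W.p| ∧ |W.p| < |aR| then -((SignType.sign W.p : SignType) : ℤ)
            else 0) := by
  obtain ⟨h₁, h₂⟩ := W.isFredholm_and_index hL hR hL_nontrivial hR_nontrivial haL haR
  have habs (a : ℝ) : (W.p ≠ a ∧ -W.p ≠ a) ↔ |W.p| ≠ |a| := by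
    rw [ne_eq, ne_eq, ne_eq, abs_eq_abs, not_or, neg_eq_iff_eq_neg]
  rw [habs, habs] at h₁
  refine ⟨h₁, fun hF => ?_⟩
  obtain ⟨hW, hi⟩ := hF.wittenIndex
  obtain ⟨nL, nR⟩ := h₁.1 hF
  refine ⟨hW, ?_⟩
  rw [hi, h₂ hF, threshold_sum nR]
  -- Cut shifts on the left half-line have the opposite index, so the left end contributes with
  -- reversed sign.
  have hneg : ((if W.p < aL then 0 else -1) + (if -W.p < aL then 0 else 1) : ℤ) =
      -((if W.p < aL then 0 else 1) + (if -W.p < aL then 0 else -1)) := by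
    split_ifs <;> rfl
  rw [hneg, threshold_sum nL]
  rcases lt_or_gt_of_ne nL with hl | hl <;> rcases lt_or_gt_of_ne nR with hr | hr <;>
    simp [hl, hr, hl.not_gt, hr.not_gt]
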